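/- Let $A$ be a ring (associative, with unit) and let $W$ be a class of morphisms between finitely generated projective right $A$-modules. An $A$-complex is a graded differential right $A$-module (graded by $\mathbf Z$, with differential of degree $-1$) which is projective and bounded from below. For $A$-complexes $C,C'$ let $\mathrm{Hom}(C,C')$ be the graded differential module of homogeneous $A$-linear maps $f$ of degree $|f|\in\mathbf Z$, with differential $d(f)=d\circ f-(-1)^{|f|}f\circ d$. A morphism $C\to C'$ is a homogeneous cycle of $\mathrm{Hom}(C,C')$, that is, a linear map of some degree which commutes with the differentials in the graded sense; it is null-homotopic if it is a boundary. Let $\mathcal C_*(A)$ be the category of $A$-complexes and these morphisms (of all degrees). A morphism is a cofibration if it is injective and its cokernel belongs to $\mathcal C_*(A)$. Let $\mathcal W_0$ be the class of complexes of length two $\cdots\to 0\to P\xrightarrow{\ \alpha\ } Q\to 0\to\cdots$ (placed in any two consecutive degrees) with $\alpha\in W$. An $A$-complex $C$ is $W$-local if every morphism from a complex in $\mathcal W_0$ to $C$ is null-homotopic; let $\mathcal L$ be the class of $W$-local complexes. Let $\mathcal W$ be the class of $A$-complexes $C$ such that every morphism from $C$ to a complex in $\mathcal L$ is null-homotopic.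 A morphism $C\to C'$ is a $W$-localization of $C$ if it is a cofibration, $C'$ belongs to $\mathcal L$, and the mapping cone of $C\to C'$ belongs to $\mathcal W$. Theorem. There exist a functor $\Phi:\mathcal C_*(A)\to\mathcal C_*(A)$, preserving the degrees of morphisms, and a natural transformation $\lambda:\mathrm{Id}\to\Phi$ consisting of morphisms of degree $0$, such that: (1) for every $A$-complex $C$, $\lambda_C:C\to\Phi(C)$ is a $W$-localization of $C$; (2) $\Phi$ sends cofibrations to cofibrations; (3) for every integer $p$, if $C$ vanishes in degrees less than $p$, then so does $\Phi(C)$. -/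

import Mathlib

open CategoryTheory

universe u

/-- Finitely generated projective right `A`-modules (right `A`-modules are modules over the
opposite ring `Aᵐᵒᵖ`), as a full subcategory of the category of all right `A`-modules. A class `W`
of morphisms between such modules is a `MorphismProperty (FGProj A)`. -/
abbrev FGProj (A : Type u) [Ring A] :=
  ObjectProperty.FullSubcategory
    (fun M : ModuleCat.{u} Aᵐᵒᵖ => Module.Finite Aᵐᵒᵖ M ∧ Module.Projective Aᵐᵒᵖ M)

/-- An `A`-complex: a graded differential right `A`-module (the differential has degree `-1`) which
is projective and bounded from below. The graded module is given as its total module, with the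
direct sum decomposition into its homogeneous parts `gr i`. -/
structure Cplx (A : Type u) [Ring A] where
  carrier : Type u
  [grp : AddCommGroup carrier]
  [mod : Module Aᵐᵒᵖ carrier]
  gr : ℤ → Submodule Aᵐᵒᵖ carrier
  isInternal : DirectSum.IsInternal gr
  d : carrier →ₗ[Aᵐᵒᵖ] carrier
  d_mem : ∀ (i : ℤ) (x : carrier), x ∈ gr i → d x ∈ gr (i - 1)
  d_d : ∀ x : carrier, d (d x) = 0
  projective : Module.Projective Aᵐᵒᵖ carrier
  bounded : ∃ p : ℤ, ∀ i : ℤ, i < p → gr i = ⊥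

namespace Cplx

variable {A : Type u} [Ring A]

attribute [instance] Cplx.grp Cplx.mod Cplx.projective

/-- The complex `C` vanishes in degrees less than `p`. -/
def VanishesBelow (C : Cplx A) (p : ℤ) : Prop :=
  ∀ i : ℤ, i < p → C.gr i = ⊥

/-- A linear map is homogeneous of degree `n`. -/
def HasDegree {C D : Cplx A} (f : C.carrier →ₗ[Aᵐᵒᵖ] D.carrier) (n : ℤ) : Prop :=
  ∀ (i : ℤ) (x : C.carrier), x ∈ C.gr i → f x ∈ D.gr (i + n)

/-- `f` is a cycle of degree `n` of the graded differential module `Hom(C, D)`: it is homogeneous of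
degree `n` and commutes with the differentials in the graded sense, `d f = (-1)^n f d`. -/
def IsCycle {C D : Cplx A} (f : C.carrier →ₗ[Aᵐᵒᵖ] D.carrier) (n : ℤ) : Prop :=
  HasDegree f n ∧ ∀ x : C.carrier, D.d (f x) = n.negOnePow • f (C.d x)

/-- Morphisms of complexes: linear maps of some degree (any integer is allowed) which commute with
the differentials in the graded sense. -/
@[ext]
structure Hom (C D : Cplx A) where
  toLin : C.carrier →ₗ[Aᵐᵒᵖ] D.carrier
  isCycle : ∃ n : ℤ, IsCycle toLin n

theorem IsCycle.id (C : Cplx A) : IsCycle (LinearMap.id : C.carrier →ₗ[Aᵐᵒᵖ] C.carrier) 0 :=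
  ⟨fun i x hx => by simpa using hx, fun x => by simp⟩

theorem IsCycle.comp {C D E : Cplx A} {f : C.carrier →ₗ[Aᵐᵒᵖ] D.carrier}
    {g : D.carrier →ₗ[Aᵐᵒᵖ] E.carrier} {n m : ℤ} (hf : IsCycle f n) (hg : IsCycle g m) :
    IsCycle (g ∘ₗ f) (n + m) := by
  refine ⟨fun i x hx => ?_, fun x => ?_⟩
  · have h := hg.1 _ _ (hf.1 i x hx)
    rwa [add_assoc] at h
  · simp only [LinearMap.comp_apply, hg.2, hf.2, Int.negOnePow_add, mul_comm n.negOnePow, mul_smul,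
      Units.smul_def, map_zsmul]

/-- The category of `A`-complexes, with morphisms of all degrees. -/
instance : Category.{u} (Cplx A) where
  Hom := Hom
  id C := ⟨LinearMap.id, 0, IsCycle.id C⟩
  comp f g := ⟨g.toLin ∘ₗ f.toLin, by
    obtain ⟨n, hn⟩ := f.isCycle
    obtain ⟨m, hm⟩ := g.isCycle
    exact ⟨n + m, hn.comp hm⟩⟩

/-- The underlying linear map of a morphism of complexes. -/
def lin {C D : Cplx A} (f : C ⟶ D) : C.carrier →ₗ[Aᵐᵒᵖ] D.carrier := Hom.toLin f

/-- A morphism is a cofibration if it is injective and its cokernel is a complex. The cokernel is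
always a graded differential module which is bounded from below, so the only condition on it is that
it is projective. -/
def IsCofibration {C D : Cplx A} (f : C ⟶ D) : Prop :=
  Function.Injective (lin f) ∧ Module.Projective Aᵐᵒᵖ (D.carrier ⧸ LinearMap.range (lin f))

/-- A morphism is null-homotopic if it is a boundary in `Hom(C, D)`, where the differential of a
homogeneous map `h` of degree `m` is `d h - (-1)^m h d`. -/
def IsNullHomotopic {C D : Cplx A} (f : C ⟶ D) : Prop :=
  ∃ (m : ℤ) (h : C.carrier →ₗ[Aᵐᵒᵖ] D.carrier), HasDegree h m ∧
    ∀ x : C.carrier, lin f x = D.d (h x) - m.negOnePow • h (C.d x)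

/-- The class `W₀` of complexes of length two `⋯ → 0 → P → Q → 0 → ⋯`, placed in any two consecutive
degrees `n + 1` and `n`, whose differential `P → Q` lies in `W`. -/
def IsTwoTerm (W : MorphismProperty (FGProj A)) (K : Cplx A) : Prop :=
  ∃ (n : ℤ) (P Q : FGProj A) (α : P ⟶ Q) (eP : P.obj ≃ₗ[Aᵐᵒᵖ] K.gr (n + 1))
    (eQ : Q.obj ≃ₗ[Aᵐᵒᵖ] K.gr n), W α ∧
    (∀ x : P.obj, K.d (eP x : K.carrier) = (eQ (α.hom.hom x) : K.carrier)) ∧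
    ∀ i : ℤ, i ≠ n + 1 → i ≠ n → K.gr i = ⊥

/-- A complex is `W`-local if every morphism from a complex in `W₀` to it is null-homotopic. -/
def IsLocal (W : MorphismProperty (FGProj A)) (C : Cplx A) : Prop :=
  ∀ K : Cplx A, IsTwoTerm W K → ∀ f : K ⟶ C, IsNullHomotopic f

/-- A complex is acyclic with respect to a class of complexes if every morphism from it to a complex
of the class is null-homotopic. -/
def IsAcyclicWrt (𝒞 : Cplx A → Prop) (C : Cplx A) : Prop :=
  ∀ L : Cplx A, 𝒞 L → ∀ f : C ⟶ L, IsNullHomotopic f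

theorem isInternal_cone (C D : Cplx A) (k : ℤ) :
    DirectSum.IsInternal (fun i : ℤ => (D.gr i).prod (C.gr (i - k))) := by
  rw [DirectSum.isInternal_submodule_iff_iSupIndep_and_iSup_eq_top]
  have hD := (DirectSum.isInternal_submodule_iff_iSupIndep_and_iSup_eq_top _).1 D.isInternal
  have hC := (DirectSum.isInternal_submodule_iff_iSupIndep_and_iSup_eq_top _).1 C.isInternal
  have hC1 : iSupIndep (fun i : ℤ => C.gr (i - k)) := hC.1.comp sub_left_injective
  have hC2 : ⨆ i : ℤ, C.gr (i - k) = ⊤ := by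
    rw [← hC.2]
    exact (Equiv.subRight k).iSup_comp (g := C.gr)
  constructor
  · intro i
    have hle : (⨆ (j : ℤ) (_ : j ≠ i), (D.gr j).prod (C.gr (j - k))) ≤
        (⨆ (j : ℤ) (_ : j ≠ i), D.gr j).prod (⨆ (j : ℤ) (_ : j ≠ i), C.gr (j - k)) :=
      iSup₂_le fun j hj => Submodule.prod_mono
        (le_iSup₂ (f := fun (j : ℤ) (_ : j ≠ i) => D.gr j) j hj)
        (le_iSup₂ (f := fun (j : ℤ) (_ : j ≠ i) => C.gr (j - k)) j hj)
    refine Disjoint.mono_right hle ?_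
    rw [disjoint_iff, Submodule.prod_inf_prod, (hD.1 i).eq_bot, (hC1 i).eq_bot,
      Submodule.prod_bot]
  · have h1 : ∀ y : D.carrier, (y, (0 : C.carrier)) ∈
        ⨆ i : ℤ, (D.gr i).prod (C.gr (i - k)) := by
      have : (⨆ i : ℤ, D.gr i) ≤ (⨆ i : ℤ, (D.gr i).prod (C.gr (i - k))).comap
          (LinearMap.inl Aᵐᵒᵖ D.carrier C.carrier) :=
        iSup_le fun i y hy => Submodule.mem_iSup_of_mem i ⟨hy, zero_mem _⟩
      intro y
      exact this (hD.2 ▸ Submodule.mem_top)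
    have h2 : ∀ x : C.carrier, ((0 : D.carrier), x) ∈
        ⨆ i : ℤ, (D.gr i).prod (C.gr (i - k)) := by
      have : (⨆ i : ℤ, C.gr (i - k)) ≤ (⨆ i : ℤ, (D.gr i).prod (C.gr (i - k))).comap
          (LinearMap.inr Aᵐᵒᵖ D.carrier C.carrier) :=
        iSup_le fun i y hy => Submodule.mem_iSup_of_mem i ⟨zero_mem _, hy⟩
      intro x
      exact this (hC2 ▸ Submodule.mem_top)
    rw [eq_top_iff]
    rintro ⟨y, x⟩ -
    simpa using add_mem (h1 y) (h2 x)

/-- The mapping cone of a morphism `f : C ⟶ D` of degree `n`: the graded module `D ⊕ C[n + 1]`,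
with an element of degree `k` of `C` placed in degree `k + n + 1`, and the differential
`(y, x) ↦ (d y + f x, (-1)^(n+1) d x)`. -/
def cone {C D : Cplx A} (f : C.carrier →ₗ[Aᵐᵒᵖ] D.carrier) (n : ℤ) (hf : IsCycle f n) :
    Cplx A where
  carrier := D.carrier × C.carrier
  gr i := (D.gr i).prod (C.gr (i - (n + 1)))
  isInternal := isInternal_cone C D (n + 1)
  d := LinearMap.prod (LinearMap.coprod D.d f)
    ((n + 1).negOnePow • (C.d ∘ₗ LinearMap.snd Aᵐᵒᵖ D.carrier C.carrier))
  d_mem i z hz := by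
    refine ⟨add_mem (D.d_mem i _ hz.1) ?_, ?_⟩
    · have h := hf.1 _ _ hz.2
      rwa [show i - (n + 1) + n = i - 1 by ring] at h
    · have h := C.d_mem _ _ hz.2
      rw [show i - (n + 1) - 1 = i - 1 - (n + 1) by ring] at h
      simpa [Units.smul_def] using zsmul_mem h _
  d_d z := by
    ext
    · simp [D.d_d, hf.2, Int.negOnePow_succ, Units.smul_def]
    · simp [C.d_d, Units.smul_def]
  projective := inferInstance
  bounded := by
    obtain ⟨p, hp⟩ := D.bounded
    obtain ⟨q, hq⟩ := C.bounded
    refine ⟨min p (q + (n + 1)), fun i hi => ?_⟩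
    rw [hp i (by omega), hq (i - (n + 1)) (by omega), Submodule.prod_bot]

/-- A morphism is a `𝒲`-equivalence if its mapping cone lies in the class `𝒲` of complexes which are
acyclic with respect to the class of `W`-local complexes. -/
def IsWEquivalence (W : MorphismProperty (FGProj A)) {C D : Cplx A} (f : C ⟶ D) : Prop :=
  ∃ (n : ℤ) (hf : IsCycle (lin f) n), IsAcyclicWrt (IsLocal W) (cone (lin f) n hf)

/-- A `W`-localization of `C` is a cofibration `C ⟶ D` which is a `𝒲`-equivalence and whose target
is `W`-local. -/
def IsWLocalization (W : MorphismProperty (FGProj A)) {C D : Cplx A} (f : C ⟶ D) : Prop :=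
  IsCofibration f ∧ IsLocal W D ∧ IsWEquivalence W f

end Cplx

/-!
The localization is built by the small object argument, in a form that respects morphisms of all
degrees.

Up to isomorphism there is only a small family of two-term complexes `K` with differential in `W`
(`Cplx.twoTermFamily`): their underlying modules are finitely generated and projective, hence
isomorphic to submodules of finitely generated free modules. Given `C`, let `cells C` be the direct
sum of the shifts `K[|g|]` over all *nonzero* morphisms `g : K ⟶ C` of any degree, and let `attach C`
be the mapping cone of the evaluation `cells C ⟶ C`. Then `Φ C` is the colimit of
`C ⟶ attach C ⟶ attach (attach C) ⟶ ⋯`, and `λ` is the inclusion of `C`.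

* Functoriality: a morphism `f : C ⟶ D` carries the cell of `g` to the cell of `g ≫ f`, or to zero
  if this composite vanishes. With the sign `(-1) ^ |g|` put into the evaluation and into the
  differential of `cells`, no further sign is needed for `f` of nonzero degree. Zero morphisms have
  to be excluded because `Φ` preserves degrees, and so must send the zero morphism, which has every
  degree, to zero.
* Lower bounds: if `C` vanishes below `p` and `g : K ⟶ C` is nonzero, where `K` lives in degrees `n`
  and `n + 1`, then `n + 1 + |g| ≥ p`, and the cell of `g` lives in degrees at least `n + 1 + |g|`
  (`Cplx.Cell.vanishesBelow`).
* Locality: `K` is finitely generated, so a morphism `K ⟶ Φ C` factors through a term of the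
  sequence; in the next term it bounds by construction
  (`Cplx.exists_nullHomotopy_localization`).
* Acyclicity of the cone: call `i : X ⟶ Y` relatively acyclic if nullhomotopies of morphisms from
  `Y` to local complexes extend from `X` to `Y` (`Cplx.IsRelAcyclic`). The cone of such an `i` is
  acyclic (`Cplx.IsRelAcyclic.isAcyclicWrt_cone`). Attaching cells is relatively acyclic, since the
  obstruction to extending over a cell is a morphism from `K` to a local complex
  (`Cplx.isRelAcyclic_attachInl`), and sequential colimits inherit the property
  (`Cplx.Tower.isRelAcyclic_incl`).
* Cofibrations: since complexes are projective, cofibrations are the morphisms with a linear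
  retraction (`Cplx.isCofibration_iff`). Retractions extend over attached cells, compatibly with the
  inclusions (`Cplx.exists_attachMap_retraction`), hence to the colimit.
-/

/-! ### Graded modules given by submodules -/

/-- A family of submodules is an internal direct sum decomposition as soon as it spans the module
and there are projections onto its members. -/
theorem DirectSum.isInternal_of_proj {R M ι : Type*} [Ring R] [AddCommGroup M] [Module R M]
    [DecidableEq ι] (gr : ι → Submodule R M) (π : ι → M →ₗ[R] M)
    (hself : ∀ i, ∀ x ∈ gr i, π i x = x) (hne : ∀ i j, i ≠ j → ∀ x ∈ gr i, π j x = 0)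
    (htop : ⨆ i, gr i = ⊤) : DirectSum.IsInternal gr := by
  refine (DirectSum.isInternal_submodule_iff_iSupIndep_and_iSup_eq_top _).2 ⟨fun i => ?_, htop⟩
  have hle : ⨆ (j) (_ : j ≠ i), gr j ≤ LinearMap.ker (π i) :=
    iSup₂_le fun j hj x hx => hne j i hj x hx
  refine Submodule.disjoint_def.2 fun x hx hx' => ?_
  rw [← hself i x hx]
  exact hle hx'

theorem LinearMap.map_sign_smul {R M N : Type*} [Ring R] [AddCommGroup M] [Module R M]
    [AddCommGroup N] [Module R N] (f : M →ₗ[R] N) (ε : ℤˣ) (x : M) : f (ε • x) = ε • f x := by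
  simp only [Units.smul_def, map_zsmul]

theorem Submodule.sign_smul_mem {R M : Type*} [Ring R] [AddCommGroup M] [Module R M]
    (N : Submodule R M) (ε : ℤˣ) {x : M} (hx : x ∈ N) : ε • x ∈ N := by
  simpa only [Units.smul_def] using zsmul_mem hx (ε : ℤ)

namespace Cplx

variable {A : Type u} [Ring A]

theorem iSup_gr (C : Cplx A) : ⨆ i, C.gr i = ⊤ :=
  C.isInternal.submodule_iSup_eq_top

theorem eq_zero_of_mem_gr (C : Cplx A) {i j : ℤ} (hij : i ≠ j) {x : C.carrier}
    (hi : x ∈ C.gr i) (hj : x ∈ C.gr j) : x = 0 :=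
  Submodule.disjoint_def.1 (C.isInternal.submodule_iSupIndep.pairwiseDisjoint hij) x hi hj

/-- The projection of a complex onto its homogeneous part of degree `i`. -/
noncomputable def proj (C : Cplx A) (i : ℤ) : C.carrier →ₗ[Aᵐᵒᵖ] C.carrier :=
  (C.gr i).subtype ∘ₗ DirectSum.component Aᵐᵒᵖ ℤ (fun i => C.gr i) i ∘ₗ
    (LinearEquiv.ofBijective (DirectSum.coeLinearMap C.gr) C.isInternal).symm.toLinearMap

theorem proj_mem (C : Cplx A) (i : ℤ) (x : C.carrier) : C.proj i x ∈ C.gr i :=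
  Subtype.coe_prop _

theorem proj_of_mem (C : Cplx A) {i : ℤ} {x : C.carrier} (hx : x ∈ C.gr i) : C.proj i x = x := by
  have := C.isInternal.ofBijective_coeLinearMap_of_mem hx
  exact congrArg Subtype.val this

theorem proj_of_mem_of_ne (C : Cplx A) {i j : ℤ} (hij : i ≠ j) {x : C.carrier}
    (hx : x ∈ C.gr i) : C.proj j x = 0 := by
  have := C.isInternal.ofBijective_coeLinearMap_of_mem_ne hij hx
  exact congrArg Subtype.val this

/-- Linear maps out of a complex are determined on homogeneous elements. -/
theorem linearMap_ext (C : Cplx A) {M : Type*} [AddCommGroup M] [Module Aᵐᵒᵖ M]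
    {f g : C.carrier →ₗ[Aᵐᵒᵖ] M} (h : ∀ i, ∀ x ∈ C.gr i, f x = g x) : f = g := by
  have hle : ⨆ i, C.gr i ≤ LinearMap.eqLocus f g := iSup_le fun i x hx => h i x hx
  ext x
  exact hle (C.iSup_gr ▸ Submodule.mem_top)

/-! ### Homogeneous maps and morphisms -/

namespace HasDegree

variable {C D E : Cplx A} {f : C.carrier →ₗ[Aᵐᵒᵖ] D.carrier} {n m : ℤ}

theorem comp {g : D.carrier →ₗ[Aᵐᵒᵖ] E.carrier} (hf : HasDegree f n) (hg : HasDegree g m) :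
    HasDegree (g ∘ₗ f) (n + m) := fun i x hx => by
  have h := hg _ _ (hf i x hx)
  rwa [add_assoc] at h

theorem proj_apply (hf : HasDegree f n) (i : ℤ) (x : C.carrier) :
    D.proj (i + n) (f x) = f (C.proj i x) := by
  suffices D.proj (i + n) ∘ₗ f = f ∘ₗ C.proj i from LinearMap.congr_fun this x
  refine C.linearMap_ext fun j y hy => ?_
  rcases eq_or_ne j i with rfl | hj
  · simp [C.proj_of_mem hy, D.proj_of_mem (hf j y hy)]
  · have hj' : j + n ≠ i + n := by omega
    simp [C.proj_of_mem_of_ne hj hy, D.proj_of_mem_of_ne hj' (hf j y hy)]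

theorem mem_of_apply_mem (hf : HasDegree f n) (hinj : Function.Injective f) {i : ℤ}
    {x : C.carrier} (hx : f x ∈ D.gr (i + n)) : x ∈ C.gr i := by
  have h : f (C.proj i x) = f x := by rw [← hf.proj_apply, D.proj_of_mem hx]
  rw [← hinj h]
  exact C.proj_mem i x

/-- A nonzero linear map has at most one degree. -/
theorem unique (hn : HasDegree f n) (hm : HasDegree f m) (hf : f ≠ 0) : n = m := by
  by_contra hne
  refine hf (C.linearMap_ext fun i x hx => ?_)
  exact D.eq_zero_of_mem_gr (i := i + n) (j := i + m) (by omega) (hn i x hx) (hm i x hx)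

protected theorem zero (n : ℤ) : HasDegree (0 : C.carrier →ₗ[Aᵐᵒᵖ] D.carrier) n :=
  fun _ _ _ => zero_mem _

theorem add {g : C.carrier →ₗ[Aᵐᵒᵖ] D.carrier} (hf : HasDegree f n) (hg : HasDegree g n) :
    HasDegree (f + g) n := fun i x hx => add_mem (hf i x hx) (hg i x hx)

theorem units_smul (hf : HasDegree f n) (ε : ℤˣ) : HasDegree (ε • f) n := fun i x hx =>
  Submodule.sign_smul_mem _ ε (hf i x hx)

end HasDegree

namespace IsCycle

variable {C D : Cplx A} {f : C.carrier →ₗ[Aᵐᵒᵖ] D.carrier} {n : ℤ}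

protected theorem zero (n : ℤ) : IsCycle (0 : C.carrier →ₗ[Aᵐᵒᵖ] D.carrier) n :=
  ⟨.zero n, fun x => by simp⟩

theorem units_smul (hf : IsCycle f n) (ε : ℤˣ) : IsCycle (ε • f) n :=
  ⟨hf.1.units_smul ε, fun x => by
    rw [LinearMap.smul_apply, LinearMap.map_sign_smul, hf.2, LinearMap.smul_apply, smul_comm]⟩

/-- A homogeneous nullhomotopy of a homogeneous cycle can be chosen of the expected degree. -/
theorem exists_nullHomotopy (hf : IsCycle f n) {k : ℤ}
    (h : C.carrier →ₗ[Aᵐᵒᵖ] D.carrier) (hh : HasDegree h k)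
    (e : ∀ x, f x = D.d (h x) - k.negOnePow • h (C.d x)) :
    ∃ h : C.carrier →ₗ[Aᵐᵒᵖ] D.carrier, HasDegree h (n + 1) ∧
      ∀ x, f x = D.d (h x) - (n + 1).negOnePow • h (C.d x) := by
  by_cases h0 : f = 0
  · exact ⟨0, .zero _, by simp [h0]⟩
  -- A nullhomotopy of degree `k` has boundary of degree `k - 1`, so `k` is forced when `f ≠ 0`.
  have hfk : HasDegree f (k - 1) := fun i x hx => by
    have h1 := D.d_mem _ _ (hh i x hx)
    have h2 := hh _ _ (C.d_mem i x hx)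
    rw [show i - 1 + k = i + (k - 1) by ring] at h2
    rw [show i + k - 1 = i + (k - 1) by ring] at h1
    rw [e]
    exact sub_mem h1 (Submodule.sign_smul_mem _ _ h2)
  obtain rfl : k = n + 1 := by have := hf.1.unique hfk h0; omega
  exact ⟨h, hh, e⟩

end IsCycle

/-- A morphism of complexes which is homogeneous of degree `n` is a cycle of degree `n`. -/
theorem HasDegree.isCycle_lin {C D : Cplx A} {f : C ⟶ D} {n : ℤ} (hf : HasDegree (lin f) n) :
    IsCycle (lin f) n := by
  obtain ⟨m, hm⟩ := Hom.isCycle f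
  change IsCycle (lin f) m at hm
  -- The degree of the cycle `f` may differ from `n` only if `f = 0`.
  by_cases h0 : lin f = 0
  · rw [h0]; exact .zero n
  · rwa [hf.unique hm.1 h0]

theorem exists_isCycle_lin {C D : Cplx A} (f : C ⟶ D) : ∃ n, IsCycle (lin f) n :=
  Hom.isCycle f

theorem hom_ext {C D : Cplx A} {f g : C ⟶ D} (h : lin f = lin g) : f = g :=
  Hom.ext h

@[simp]
theorem lin_comp {C D E : Cplx A} (f : C ⟶ D) (g : D ⟶ E) : lin (f ≫ g) = lin g ∘ₗ lin f := rfl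

@[simp]
theorem lin_id (C : Cplx A) : lin (𝟙 C) = LinearMap.id := rfl

/-- The morphism of complexes given by a homogeneous cycle. -/
def ofIsCycle {C D : Cplx A} (f : C.carrier →ₗ[Aᵐᵒᵖ] D.carrier) (n : ℤ) (hf : IsCycle f n) :
    C ⟶ D :=
  Hom.mk f ⟨n, hf⟩

@[simp]
theorem lin_ofIsCycle {C D : Cplx A} (f : C.carrier →ₗ[Aᵐᵒᵖ] D.carrier) (n : ℤ)
    (hf : IsCycle f n) : lin (ofIsCycle f n hf) = f := rfl

/-! ### Cofibrations -/

/-- Since complexes are projective, cofibrations are the morphisms with a linear retraction. -/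
theorem isCofibration_iff {C D : Cplx A} (f : C ⟶ D) :
    IsCofibration f ↔ ∃ r : D.carrier →ₗ[Aᵐᵒᵖ] C.carrier, r ∘ₗ lin f = LinearMap.id := by
  constructor
  · rintro ⟨hinj, hproj⟩
    obtain ⟨s, hs⟩ := Module.projective_lifting_property (LinearMap.range (lin f)).mkQ
      LinearMap.id (Submodule.mkQ_surjective _)
    have hmem : ∀ y, (LinearMap.id - s ∘ₗ (LinearMap.range (lin f)).mkQ :
        D.carrier →ₗ[Aᵐᵒᵖ] D.carrier) y ∈ LinearMap.range (lin f) := fun y => by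
      rw [← Submodule.Quotient.mk_eq_zero]
      have := LinearMap.congr_fun hs (Submodule.Quotient.mk y)
      simp only [LinearMap.comp_apply, Submodule.mkQ_apply, LinearMap.id_apply] at this
      simp [-Submodule.Quotient.mk_eq_zero, this]
    refine ⟨(LinearEquiv.ofInjective (lin f) hinj).symm.toLinearMap ∘ₗ
      LinearMap.codRestrict _ _ hmem, ?_⟩
    ext x
    apply hinj
    have h0 : (Submodule.Quotient.mk (lin f x) : D.carrier ⧸ LinearMap.range (lin f)) = 0 :=
      (Submodule.Quotient.mk_eq_zero _).2 ⟨x, rfl⟩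
    simp [h0]
  · rintro ⟨r, hr⟩
    have hr' : ∀ x, r (lin f x) = x := LinearMap.congr_fun hr
    refine ⟨Function.LeftInverse.injective hr', ?_⟩
    refine Module.Projective.of_split
      ((LinearMap.range (lin f)).liftQ (LinearMap.id - lin f ∘ₗ r) ?_)
      (LinearMap.range (lin f)).mkQ ?_
    · rintro _ ⟨x, rfl⟩
      simp [hr']
    · ext y
      simp

/-! ### Relative acyclicity -/

/-- A morphism `i : X ⟶ Y` of degree zero is acyclic relative to a class of complexes if
nullhomotopies of morphisms from `Y` to complexes of the class can be extended from `X` to `Y`. -/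
def IsRelAcyclic (𝒞 : Cplx A → Prop) {X Y : Cplx A} (i : X.carrier →ₗ[Aᵐᵒᵖ] Y.carrier) : Prop :=
  ∀ L : Cplx A, 𝒞 L → ∀ (n : ℤ) (f : Y.carrier →ₗ[Aᵐᵒᵖ] L.carrier), IsCycle f n →
    ∀ h : X.carrier →ₗ[Aᵐᵒᵖ] L.carrier, HasDegree h (n + 1) →
      (∀ x, f (i x) = L.d (h x) - (n + 1).negOnePow • h (X.d x)) →
      ∃ k : Y.carrier →ₗ[Aᵐᵒᵖ] L.carrier, k ∘ₗ i = h ∧ HasDegree k (n + 1) ∧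
        ∀ y, f y = L.d (k y) - (n + 1).negOnePow • k (Y.d y)

theorem cone_zero_d {X Y : Cplx A} {i : X.carrier →ₗ[Aᵐᵒᵖ] Y.carrier} (hi : IsCycle i 0)
    (y : Y.carrier) (x : X.carrier) : (cone i 0 hi).d (y, x) = (Y.d y + i x, -X.d x) := by
  refine Prod.ext rfl ?_
  change (0 + 1 : ℤ).negOnePow • X.d x = -X.d x
  simp

/-- The cone of a relatively acyclic morphism is acyclic. On the summand `X` of the cone, a morphism
from the cone is a nullhomotopy of its restriction to `X` along `i`; extended to `Y`, it is a
nullhomotopy of the given morphism. -/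
theorem IsRelAcyclic.isAcyclicWrt_cone {𝒞 : Cplx A → Prop} {X Y : Cplx A}
    {i : X.carrier →ₗ[Aᵐᵒᵖ] Y.carrier} (hi : IsCycle i 0) (h : IsRelAcyclic 𝒞 i) :
    IsAcyclicWrt 𝒞 (cone i 0 hi) := by
  intro L hL f
  obtain ⟨n, hf⟩ := exists_isCycle_lin f
  let F : (Y.carrier × X.carrier) →ₗ[Aᵐᵒᵖ] L.carrier := lin f
  have hF : ∀ y x, L.d (F (y, x)) = n.negOnePow • F (Y.d y + i x, - X.d x) := fun y x => by
    have := hf.2 (y, x)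
    rwa [cone_zero_d] at this
  have hFd : ∀ j, ∀ y ∈ Y.gr j, ∀ x ∈ X.gr (j - 1), F (y, x) ∈ L.gr (j + n) :=
    fun j y hy x hx => hf.1 j (y, x) ⟨hy, by simpa using hx⟩
  let f₁ := F ∘ₗ LinearMap.inl Aᵐᵒᵖ Y.carrier X.carrier
  let f₂ := F ∘ₗ LinearMap.inr Aᵐᵒᵖ Y.carrier X.carrier
  have hadd : ∀ y x, F (y, x) = f₁ y + f₂ x := fun y x => by
    simp [f₁, f₂, ← map_add]
  have h₁ : IsCycle f₁ n := ⟨fun j y hy => hFd j y hy 0 (zero_mem _), fun y => by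
    have := hF y 0
    simpa [f₁] using this⟩
  have h₂ : HasDegree f₂ (n + 1) := fun j x hx => by
    have := hFd (j + 1) 0 (zero_mem _) x (by simpa using hx)
    rwa [show j + 1 + n = j + (n + 1) by ring] at this
  have h₂d : ∀ x, L.d (f₂ x) = n.negOnePow • (f₁ (i x) - f₂ (X.d x)) := fun x => by
    have := hF 0 x
    simpa [hadd, sub_eq_add_neg] using this
  have hsq : ∀ z : L.carrier, n.negOnePow • n.negOnePow • z = z := fun z => by
    rw [smul_smul, Int.units_mul_self, one_smul]
  obtain ⟨k, hk, hkd, hke⟩ := h L hL n f₁ h₁ (n.negOnePow • f₂) (h₂.units_smul _) fun x => by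
    have e : L.d ((n.negOnePow • f₂) x) = f₁ (i x) - f₂ (X.d x) := by
      rw [LinearMap.smul_apply, LinearMap.map_sign_smul, h₂d, hsq]
    rw [e, LinearMap.smul_apply, Int.negOnePow_succ, Units.neg_smul, hsq]
    abel
  refine ⟨n + 1, k ∘ₗ LinearMap.fst Aᵐᵒᵖ Y.carrier X.carrier, fun j z hz => hkd j _ hz.1, ?_⟩
  rintro ⟨y, x⟩
  change F (y, x) = L.d (k y) - (n + 1).negOnePow • k (Y.d y + i x)
  have hkx : k (i x) = n.negOnePow • f₂ x := LinearMap.congr_fun hk x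
  rw [hadd, hke y, map_add, hkx, Int.negOnePow_succ]
  simp only [Units.neg_smul, smul_add, hsq]
  abel

end Cplx

namespace Cplx

variable {A : Type u} [Ring A]

/-! ### Direct sums of shifted complexes -/

section ShiftSum

variable {ι : Type u} (K : ι → Cplx A) (n : ι → ℤ)

/-- The homogeneous part of degree `j` of the direct sum of the shifts `K i [n i]`. -/
def shiftSumGr (j : ℤ) : Submodule Aᵐᵒᵖ (Π₀ i, (K i).carrier) :=
  ⨅ i, ((K i).gr (j - n i)).comap (DFinsupp.lapply i)

variable {K n}

theorem mem_shiftSumGr {j : ℤ} {x : Π₀ i, (K i).carrier} :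
    x ∈ shiftSumGr K n j ↔ ∀ i, x i ∈ (K i).gr (j - n i) := by
  simp [shiftSumGr]

variable [DecidableEq ι]

theorem single_mem_shiftSumGr {i : ι} {j : ℤ} {x : (K i).carrier} (hx : x ∈ (K i).gr (j - n i)) :
    (DFinsupp.single i x : Π₀ i, (K i).carrier) ∈ shiftSumGr K n j := by
  refine mem_shiftSumGr.2 fun i' => ?_
  rcases eq_or_ne i i' with rfl | h
  · simpa using hx
  · simp [DFinsupp.single_eq_of_ne h.symm]

theorem shiftSumGr_le {j : ℤ} {N : Submodule Aᵐᵒᵖ (Π₀ i, (K i).carrier)}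
    (h : ∀ i, ∀ x ∈ (K i).gr (j - n i), DFinsupp.single i x ∈ N) : shiftSumGr K n j ≤ N := by
  classical
  intro x hx
  rw [← DFinsupp.sum_single (f := x)]
  exact Submodule.dfinsuppSum_mem _ _ _ fun i _ => h i _ (mem_shiftSumGr.1 hx i)

variable (K n)

/-- The direct sum of the shifts `K i [n i]`: an element of degree `k` of `K i` has degree `k + n i`
in the sum, and the differential of `K i` is multiplied by `(-1) ^ n i`. -/
def shiftSum (hb : ∃ p : ℤ, ∀ i, (K i).VanishesBelow (p - n i)) : Cplx A where
  carrier := Π₀ i, (K i).carrier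
  gr := shiftSumGr K n
  isInternal := by
    refine DirectSum.isInternal_of_proj _
      (fun j => DFinsupp.mapRange.linearMap fun i => (K i).proj (j - n i)) ?_ ?_ ?_
    · intro j x hx
      ext i
      simp [(K i).proj_of_mem (mem_shiftSumGr.1 hx i)]
    · intro j j' hj x hx
      ext i
      have : j - n i ≠ j' - n i := by omega
      simp [(K i).proj_of_mem_of_ne this (mem_shiftSumGr.1 hx i)]
    · rw [eq_top_iff, ← DFinsupp.iSup_range_lsingle, iSup_le_iff]
      rintro i _ ⟨x, rfl⟩
      have hle : ⨆ j, (K i).gr j ≤ (⨆ j, shiftSumGr K n j).comap (DFinsupp.lsingle i) :=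
        iSup_le fun j y hy => Submodule.mem_iSup_of_mem (j + n i)
          (single_mem_shiftSumGr (by simpa using hy))
      exact hle ((K i).iSup_gr ▸ Submodule.mem_top)
  d := DFinsupp.mapRange.linearMap fun i => (n i).negOnePow • (K i).d
  d_mem j x hx := mem_shiftSumGr.2 fun i => by
    have h := (K i).d_mem _ _ (mem_shiftSumGr.1 hx i)
    rw [show j - n i - 1 = j - 1 - n i by ring] at h
    exact Submodule.sign_smul_mem _ _ h
  d_d x := by
    ext i
    change (n i).negOnePow • (K i).d ((n i).negOnePow • (K i).d (x i)) = 0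
    rw [LinearMap.map_sign_smul, (K i).d_d, smul_zero, smul_zero]
  projective := inferInstance
  bounded := by
    obtain ⟨p, hp⟩ := hb
    refine ⟨p, fun j hj => eq_bot_iff.2 (shiftSumGr_le fun i x hx => ?_)⟩
    rw [hp i (j - n i) (by omega)] at hx
    simp [(Submodule.mem_bot _).1 hx]

variable {K n} {hb : ∃ p : ℤ, ∀ i, (K i).VanishesBelow (p - n i)}

theorem shiftSum_vanishesBelow {p : ℤ} (hp : ∀ i, (K i).VanishesBelow (p - n i)) :
    (shiftSum K n hb).VanishesBelow p := by
  refine fun j hj => eq_bot_iff.2 (shiftSumGr_le fun i x hx => ?_)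
  rw [hp i (j - n i) (by omega), Submodule.mem_bot] at hx
  rw [hx, DFinsupp.single_zero]
  exact zero_mem _

variable (hb) in
/-- The inclusion of a summand, which is homogeneous of degree `n i`. -/
def shiftSumIncl (i : ι) : (K i).carrier →ₗ[Aᵐᵒᵖ] (shiftSum K n hb).carrier :=
  DFinsupp.lsingle (M := fun i => (K i).carrier) i

theorem isCycle_shiftSumIncl (i : ι) : IsCycle (shiftSumIncl hb i) (n i) := by
  refine ⟨fun j x hx => single_mem_shiftSumGr (by simpa using hx), fun x => ?_⟩
  refine (DFinsupp.mapRange_single (hf := fun i => map_zero _)).trans ?_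
  exact LinearMap.map_sign_smul (shiftSumIncl hb i) _ _

theorem shiftSum_ext {M : Type*} [AddCommGroup M] [Module Aᵐᵒᵖ M]
    {f g : (shiftSum K n hb).carrier →ₗ[Aᵐᵒᵖ] M}
    (h : ∀ i x, f (shiftSumIncl hb i x) = g (shiftSumIncl hb i x)) : f = g :=
  DFinsupp.lhom_ext (M := fun i => (K i).carrier) h

variable (hb) in
/-- The linear map out of a direct sum of shifts with the given restrictions to the summands. -/
def shiftSumDesc {M : Type*} [AddCommGroup M] [Module Aᵐᵒᵖ M]
    (f : ∀ i, (K i).carrier →ₗ[Aᵐᵒᵖ] M) : (shiftSum K n hb).carrier →ₗ[Aᵐᵒᵖ] M :=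
  DFinsupp.lsum (M := fun i => (K i).carrier) ℕ f

@[simp]
theorem shiftSumDesc_incl {M : Type*} [AddCommGroup M] [Module Aᵐᵒᵖ M]
    (f : ∀ i, (K i).carrier →ₗ[Aᵐᵒᵖ] M) (i : ι) (x : (K i).carrier) :
    shiftSumDesc hb f (shiftSumIncl hb i x) = f i x :=
  DFinsupp.lsum_single (M := fun i => (K i).carrier) ℕ f i x

theorem hasDegree_shiftSumDesc {D : Cplx A} {m : ℤ}
    {f : ∀ i, (K i).carrier →ₗ[Aᵐᵒᵖ] D.carrier} (hf : ∀ i, HasDegree (f i) (n i + m)) :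
    HasDegree (shiftSumDesc hb f) m := fun j =>
  shiftSumGr_le (N := (D.gr (j + m)).comap (shiftSumDesc hb f)) fun i x hx => by
    have h := hf i _ x hx
    rw [show j - n i + (n i + m) = j + m by ring, ← shiftSumDesc_incl (hb := hb) f] at h
    exact h

theorem isCycle_shiftSumDesc {D : Cplx A} {m : ℤ}
    {f : ∀ i, (K i).carrier →ₗ[Aᵐᵒᵖ] D.carrier} (hf : ∀ i, IsCycle (f i) (n i + m)) :
    IsCycle (shiftSumDesc hb f) m := by
  refine ⟨hasDegree_shiftSumDesc fun i => (hf i).1, ?_⟩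
  suffices D.d ∘ₗ shiftSumDesc hb f =
      m.negOnePow • (shiftSumDesc hb f ∘ₗ (shiftSum K n hb).d) from LinearMap.congr_fun this
  refine shiftSum_ext fun i x => ?_
  simp only [LinearMap.comp_apply, LinearMap.smul_apply, (isCycle_shiftSumIncl i).2,
    LinearMap.map_sign_smul, shiftSumDesc_incl, (hf i).2, Int.negOnePow_add, mul_smul]
  rw [smul_comm]

/-- A morphism out of a direct sum of shifts is null-homotopic if its restrictions to the summands
are. -/
theorem exists_nullHomotopy_shiftSum {L : Cplx A} {m : ℤ}
    {f : (shiftSum K n hb).carrier →ₗ[Aᵐᵒᵖ] L.carrier} (hf : IsCycle f m)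
    (hK : ∀ i, ∀ g : K i ⟶ L, IsNullHomotopic g) :
    ∃ h : (shiftSum K n hb).carrier →ₗ[Aᵐᵒᵖ] L.carrier, HasDegree h (m + 1) ∧
      ∀ x, f x = L.d (h x) - (m + 1).negOnePow • h ((shiftSum K n hb).d x) := by
  have hnull : ∀ i, ∃ h : (K i).carrier →ₗ[Aᵐᵒᵖ] L.carrier, HasDegree h (n i + m + 1) ∧
      ∀ x, f (shiftSumIncl hb i x) = L.d (h x) - (n i + m + 1).negOnePow • h ((K i).d x) :=
    fun i => by
      have hcyc := (isCycle_shiftSumIncl (hb := hb) i).comp hf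
      obtain ⟨k, h, hh, e⟩ := hK i (ofIsCycle _ _ hcyc)
      exact hcyc.exists_nullHomotopy h hh e
  choose h hh he using hnull
  refine ⟨shiftSumDesc hb h, hasDegree_shiftSumDesc fun i => ?_, ?_⟩
  · rw [← add_assoc]
    exact hh i
  · suffices f = L.d ∘ₗ shiftSumDesc hb h -
        (m + 1).negOnePow • (shiftSumDesc hb h ∘ₗ (shiftSum K n hb).d) from
      LinearMap.congr_fun this
    refine shiftSum_ext fun i x => ?_
    simp only [he, LinearMap.sub_apply, LinearMap.comp_apply, LinearMap.smul_apply,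
      (isCycle_shiftSumIncl i).2, LinearMap.map_sign_smul, shiftSumDesc_incl, smul_smul,
      ← Int.negOnePow_add]
    rw [show m + 1 + n i = n i + m + 1 by ring]

end ShiftSum

/-! ### Attaching cells -/

/-- A small family of test complexes, each finitely generated and concentrated in two consecutive
degrees. -/
structure TestFamily (A : Type u) [Ring A] where
  /-- The indexing type of the family. -/
  ι : Type u
  /-- The test complexes. -/
  K : ι → Cplx A
  narrow : ∀ s, ∃ n : ℤ, ∀ i, i ≠ n + 1 → i ≠ n → (K s).gr i = ⊥
  finite : ∀ s, Module.Finite Aᵐᵒᵖ (K s).carrier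

variable (T : TestFamily A)

/-- A cell to be attached to `C`: a nonzero morphism, of any degree, from a test complex to `C`.
Zero morphisms are excluded so that attaching cells sends the zero morphism, which is homogeneous of
every degree, to the zero morphism. -/
structure Cell (C : Cplx A) where
  /-- The index of the test complex. -/
  idx : T.ι
  /-- The attaching morphism. -/
  map : T.K idx ⟶ C
  ne_zero : lin map ≠ 0

noncomputable instance (C : Cplx A) : DecidableEq (Cell T C) := Classical.decEq _

variable {T}

/-- The degree of the attaching morphism of a cell. -/
noncomputable def Cell.deg {C : Cplx A} (c : Cell T C) : ℤ :=
  (exists_isCycle_lin c.map).choose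

theorem Cell.isCycle {C : Cplx A} (c : Cell T C) : IsCycle (lin c.map) c.deg :=
  (exists_isCycle_lin c.map).choose_spec

/-- If `C` vanishes below `p`, a nonzero morphism of degree `m` from a test complex in degrees `n`
and `n + 1` to `C` forces `p ≤ n + 1 + m`, so the test complex vanishes below `p - 1 - m`. -/
theorem Cell.vanishesBelow {C : Cplx A} {p : ℤ} (hp : C.VanishesBelow p) (c : Cell T C) :
    (T.K c.idx).VanishesBelow (p - 1 - c.deg) := by
  intro i hi
  obtain ⟨n, hn⟩ := T.narrow c.idx
  by_contra hne
  have hin : i = n + 1 ∨ i = n := by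
    by_contra! h
    exact hne (hn i h.1 h.2)
  refine c.ne_zero (linearMap_ext _ fun j x hx => ?_)
  by_cases hj : j = n + 1 ∨ j = n
  · have := c.isCycle.1 j x hx
    rw [hp _ (by omega)] at this
    simpa using this
  · push Not at hj
    rw [hn j hj.1 hj.2] at hx
    simp [(Submodule.mem_bot _).1 hx]

theorem Cell.bounded (C : Cplx A) :
    ∃ p : ℤ, ∀ c : Cell T C, (T.K c.idx).VanishesBelow (p - c.deg) := by
  obtain ⟨p, hp⟩ := C.bounded
  exact ⟨p - 1, fun c => c.vanishesBelow hp⟩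

variable (T)

/-- The complex of cells: the direct sum of the test complexes over all nonzero morphisms to `C`,
each shifted by the degree of the morphism. -/
noncomputable def cells (C : Cplx A) : Cplx A :=
  shiftSum (fun c : Cell T C => T.K c.idx) Cell.deg (Cell.bounded C)

variable {T} {C D E : Cplx A}

open Classical in
/-- The inclusion of the cell given by a morphism, which is zero for the zero morphism. -/
noncomputable def cellIncl {s : T.ι} (g : T.K s ⟶ C) :
    (T.K s).carrier →ₗ[Aᵐᵒᵖ] (cells T C).carrier :=
  if hg : lin g = 0 then 0 else shiftSumIncl (Cell.bounded C) ⟨s, g, hg⟩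

theorem cellIncl_eq_zero {s : T.ι} {g : T.K s ⟶ C} (hg : lin g = 0) : cellIncl g = 0 :=
  dif_pos hg

theorem cellIncl_map (c : Cell T C) : cellIncl c.map = shiftSumIncl (Cell.bounded C) c :=
  dif_neg c.ne_zero

/-- Linear maps out of the complex of cells are determined on the cells. -/
theorem cells_ext {M : Type*} [AddCommGroup M] [Module Aᵐᵒᵖ M]
    {f g : (cells T C).carrier →ₗ[Aᵐᵒᵖ] M}
    (h : ∀ (c : Cell T C) x, f (cellIncl c.map x) = g (cellIncl c.map x)) : f = g :=
  shiftSum_ext fun c x => by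
    have := h c x
    rw [cellIncl_map] at this
    exact this

/-- The linear map out of the complex of cells with the given restrictions to the cells. -/
noncomputable def cellsDesc {M : Type*} [AddCommGroup M] [Module Aᵐᵒᵖ M]
    (f : ∀ c : Cell T C, (T.K c.idx).carrier →ₗ[Aᵐᵒᵖ] M) : (cells T C).carrier →ₗ[Aᵐᵒᵖ] M :=
  shiftSumDesc (Cell.bounded C) f

@[simp]
theorem cellsDesc_cellIncl {M : Type*} [AddCommGroup M] [Module Aᵐᵒᵖ M]
    (f : ∀ c : Cell T C, (T.K c.idx).carrier →ₗ[Aᵐᵒᵖ] M) (c : Cell T C)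
    (x : (T.K c.idx).carrier) : cellsDesc f (cellIncl c.map x) = f c x := by
  rw [cellIncl_map]
  exact shiftSumDesc_incl f c x

theorem isCycle_cellsDesc {f : ∀ c : Cell T C, (T.K c.idx).carrier →ₗ[Aᵐᵒᵖ] D.carrier} {m : ℤ}
    (hf : ∀ c, IsCycle (f c) (c.deg + m)) : IsCycle (cellsDesc f) m :=
  isCycle_shiftSumDesc hf

theorem isCycle_cellIncl {s : T.ι} {g : T.K s ⟶ C} {n : ℤ} (hg : IsCycle (lin g) n) :
    IsCycle (cellIncl g) n := by
  by_cases h0 : lin g = 0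
  · rw [cellIncl_eq_zero h0]
    exact .zero n
  · let c : Cell T C := ⟨s, g, h0⟩
    obtain rfl : n = c.deg := hg.1.unique c.isCycle.1 h0
    change IsCycle (cellIncl c.map) c.deg
    rw [cellIncl_map]
    exact isCycle_shiftSumIncl c

variable (T) in
/-- The evaluation morphism from the complex of cells, given on a cell by its attaching morphism
`g`, multiplied by `(-1) ^ |g|`. -/
noncomputable def cellsEval (C : Cplx A) : (cells T C).carrier →ₗ[Aᵐᵒᵖ] C.carrier :=
  cellsDesc fun c => c.deg.negOnePow • lin c.map

theorem isCycle_cellsEval (C : Cplx A) : IsCycle (cellsEval T C) 0 :=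
  isCycle_cellsDesc fun c => by
    rw [add_zero]
    exact c.isCycle.units_smul _

theorem cellsEval_cellIncl {s : T.ι} {g : T.K s ⟶ C} {n : ℤ} (hg : IsCycle (lin g) n)
    (x : (T.K s).carrier) : cellsEval T C (cellIncl g x) = n.negOnePow • lin g x := by
  by_cases h0 : lin g = 0
  · simp [cellIncl_eq_zero h0, h0]
  · let c : Cell T C := ⟨s, g, h0⟩
    obtain rfl : n = c.deg := hg.1.unique c.isCycle.1 h0
    exact cellsDesc_cellIncl _ c x

variable (T) in
/-- The map of complexes of cells induced by a morphism `f`; it sends the cell of `g` to the cell of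
the composite of `g` and `f`. -/
noncomputable def cellsMap (f : C ⟶ D) : (cells T C).carrier →ₗ[Aᵐᵒᵖ] (cells T D).carrier :=
  cellsDesc fun c => cellIncl (c.map ≫ f)

@[simp]
theorem cellsMap_cellIncl (f : C ⟶ D) {s : T.ι} (g : T.K s ⟶ C) (x : (T.K s).carrier) :
    cellsMap T f (cellIncl g x) = cellIncl (g ≫ f) x := by
  by_cases h0 : lin g = 0
  · have h1 : lin (g ≫ f) = 0 := by simp [h0]
    simp [cellIncl_eq_zero h0, cellIncl_eq_zero h1]
  · exact cellsDesc_cellIncl _ ⟨s, g, h0⟩ x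

theorem isCycle_cellsMap {f : C ⟶ D} {m : ℤ} (hf : IsCycle (lin f) m) :
    IsCycle (cellsMap T f) m :=
  isCycle_cellsDesc fun c => isCycle_cellIncl (c.isCycle.comp hf)

theorem cellsEval_cellsMap {f : C ⟶ D} {m : ℤ} (hf : IsCycle (lin f) m) (x : (cells T C).carrier) :
    cellsEval T D (cellsMap T f x) = m.negOnePow • lin f (cellsEval T C x) := by
  suffices cellsEval T D ∘ₗ cellsMap T f = m.negOnePow • (lin f ∘ₗ cellsEval T C) from
    LinearMap.congr_fun this x
  refine cells_ext fun c x => ?_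
  have h := c.isCycle.comp hf
  simp only [LinearMap.comp_apply, LinearMap.smul_apply, cellsMap_cellIncl,
    cellsEval_cellIncl c.isCycle, LinearMap.map_sign_smul]
  rw [cellsEval_cellIncl (g := c.map ≫ f) h, add_comm, Int.negOnePow_add, mul_smul]
  rfl

variable (T) in
/-- The complex obtained from `C` by attaching a cone on each test complex along each nonzero
morphism to `C`: the mapping cone of the evaluation morphism. -/
noncomputable def attach (C : Cplx A) : Cplx A :=
  cone (cellsEval T C) 0 (isCycle_cellsEval C)

variable (T) in
/-- The inclusion of `C` into the complex obtained by attaching cells. -/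
noncomputable def attachInl (C : Cplx A) : C.carrier →ₗ[Aᵐᵒᵖ] (attach T C).carrier :=
  LinearMap.inl Aᵐᵒᵖ C.carrier (cells T C).carrier

variable (T) in
/-- The inclusion of the cells, which raises degrees by one. -/
noncomputable def attachInr (C : Cplx A) : (cells T C).carrier →ₗ[Aᵐᵒᵖ] (attach T C).carrier :=
  LinearMap.inr Aᵐᵒᵖ C.carrier (cells T C).carrier

/-- The linear map out of `attach T C` with given restrictions to `C` and to the cells. -/
noncomputable def attachDesc {M : Type*} [AddCommGroup M] [Module Aᵐᵒᵖ M]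
    (f : C.carrier →ₗ[Aᵐᵒᵖ] M) (g : (cells T C).carrier →ₗ[Aᵐᵒᵖ] M) :
    (attach T C).carrier →ₗ[Aᵐᵒᵖ] M :=
  LinearMap.coprod f g

section attachDesc

variable {M : Type*} [AddCommGroup M] [Module Aᵐᵒᵖ M]

@[simp]
theorem attachDesc_inl (f : C.carrier →ₗ[Aᵐᵒᵖ] M) (g : (cells T C).carrier →ₗ[Aᵐᵒᵖ] M)
    (y : C.carrier) : attachDesc f g (attachInl T C y) = f y :=
  LinearMap.congr_fun (LinearMap.coprod_inl f g) y

@[simp]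
theorem attachDesc_inr (f : C.carrier →ₗ[Aᵐᵒᵖ] M) (g : (cells T C).carrier →ₗ[Aᵐᵒᵖ] M)
    (x : (cells T C).carrier) : attachDesc f g (attachInr T C x) = g x :=
  LinearMap.congr_fun (LinearMap.coprod_inr f g) x

theorem attach_ext {f g : (attach T C).carrier →ₗ[Aᵐᵒᵖ] M}
    (h₁ : ∀ y, f (attachInl T C y) = g (attachInl T C y))
    (h₂ : ∀ x, f (attachInr T C x) = g (attachInr T C x)) : f = g :=
  LinearMap.prod_ext (LinearMap.ext h₁) (LinearMap.ext h₂)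

end attachDesc

theorem hasDegree_attachInr (C : Cplx A) : HasDegree (attachInr T C) 1 := fun i x hx => by
  refine ⟨zero_mem _, ?_⟩
  rwa [show i + 1 - (0 + 1) = i by ring]

theorem isCycle_attachInl (C : Cplx A) : IsCycle (attachInl T C) 0 := by
  refine ⟨fun i x hx => ⟨(add_zero i).symm ▸ hx, zero_mem _⟩, fun x => ?_⟩
  refine (cone_zero_d _ x 0).trans ?_
  rw [Int.negOnePow_zero, one_smul, map_zero, map_zero, add_zero, neg_zero]
  rfl

@[simp]
theorem attach_d_inl (y : C.carrier) :
    (attach T C).d (attachInl T C y) = attachInl T C (C.d y) := by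
  simp [(isCycle_attachInl C).2]

@[simp]
theorem attach_d_inr (x : (cells T C).carrier) : (attach T C).d (attachInr T C x) =
    attachInl T C (cellsEval T C x) - attachInr T C ((cells T C).d x) := by
  refine (cone_zero_d _ 0 x).trans ?_
  rw [map_zero, zero_add, sub_eq_add_neg, ← map_neg (attachInr T C)]
  exact Prod.ext (add_zero _).symm (zero_add _).symm

theorem hasDegree_attachDesc {f : C.carrier →ₗ[Aᵐᵒᵖ] D.carrier}
    {g : (cells T C).carrier →ₗ[Aᵐᵒᵖ] D.carrier} {m : ℤ} (hf : HasDegree f m)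
    (hg : HasDegree g (m + 1)) : HasDegree (attachDesc f g) m := fun i z hz => by
  refine add_mem (hf i _ hz.1) ?_
  have := hg _ _ hz.2
  rwa [show i - (0 + 1) + (m + 1) = i + m by ring] at this

theorem attach_vanishesBelow {p : ℤ} (hp : C.VanishesBelow p) : (attach T C).VanishesBelow p := by
  intro i hi
  have h : (cells T C).VanishesBelow (p - 1) := shiftSum_vanishesBelow fun c => c.vanishesBelow hp
  change (C.gr i).prod ((cells T C).gr (i - (0 + 1))) = ⊥
  rw [hp i hi, h (i - (0 + 1)) (by omega), Submodule.prod_bot]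

variable (T) in
/-- The map induced by a morphism on complexes with cells attached. -/
noncomputable def attachMap (f : C ⟶ D) : (attach T C).carrier →ₗ[Aᵐᵒᵖ] (attach T D).carrier :=
  attachDesc (attachInl T D ∘ₗ lin f) (attachInr T D ∘ₗ cellsMap T f)

@[simp]
theorem attachMap_inl (f : C ⟶ D) (y : C.carrier) :
    attachMap T f (attachInl T C y) = attachInl T D (lin f y) :=
  attachDesc_inl _ _ y

@[simp]
theorem attachMap_inr (f : C ⟶ D) (x : (cells T C).carrier) :
    attachMap T f (attachInr T C x) = attachInr T D (cellsMap T f x) :=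
  attachDesc_inr _ _ x

theorem isCycle_attachMap {f : C ⟶ D} {m : ℤ} (hf : IsCycle (lin f) m) :
    IsCycle (attachMap T f) m := by
  refine ⟨hasDegree_attachDesc ?_ ((isCycle_cellsMap hf).1.comp (hasDegree_attachInr D)), ?_⟩
  · have := hf.1.comp (isCycle_attachInl (T := T) D).1
    rwa [add_zero] at this
  · suffices (attach T D).d ∘ₗ attachMap T f = m.negOnePow • (attachMap T f ∘ₗ (attach T C).d) from
      LinearMap.congr_fun this
    refine attach_ext (fun y => ?_) fun x => ?_
    · simp [hf.2]
    · simp [cellsEval_cellsMap hf, (isCycle_cellsMap hf).2, smul_sub]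

variable (T) in
/-- Attaching cells is functorial: cells are carried to cells by composition. -/
noncomputable def attachFunctor : Cplx A ⥤ Cplx A where
  obj C := attach T C
  map f := ofIsCycle (attachMap T f) _ (isCycle_attachMap (exists_isCycle_lin f).choose_spec)
  map_id C := by
    refine hom_ext (attach_ext (fun y => ?_) fun x => ?_)
    · simp
    · have h : cellsMap T (𝟙 C) = LinearMap.id := cells_ext fun c x => by simp
      simp [h]
  map_comp f g := by
    refine hom_ext (attach_ext (fun y => ?_) fun x => ?_)
    · simp
    · have h : cellsMap T (f ≫ g) = cellsMap T g ∘ₗ cellsMap T f := cells_ext fun c x => by simp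
      simp [h]

/-- A linear retraction of `f` extends to a linear retraction of the map induced on complexes with
cells attached; cells not in the image of the map are sent to zero. -/
theorem exists_attachMap_retraction (f : C ⟶ D) (r : D.carrier →ₗ[Aᵐᵒᵖ] C.carrier)
    (hr : r ∘ₗ lin f = LinearMap.id) :
    ∃ r' : (attach T D).carrier →ₗ[Aᵐᵒᵖ] (attach T C).carrier,
      r' ∘ₗ attachMap T f = LinearMap.id ∧ ∀ x, r' (attachInl T D x) = attachInl T C (r x) := by
  classical
  have hinj : ∀ x, r (lin f x) = x := LinearMap.congr_fun hr
  let φ : ∀ c : Cell T D, (T.K c.idx).carrier →ₗ[Aᵐᵒᵖ] (cells T C).carrier := fun c =>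
    if h : ∃ g : T.K c.idx ⟶ C, g ≫ f = c.map then cellIncl h.choose else 0
  have hρ : cellsDesc φ ∘ₗ cellsMap T f = LinearMap.id := cells_ext fun c x => by
    have hne : lin (c.map ≫ f) ≠ 0 := fun h0 => c.ne_zero <| LinearMap.ext fun x => by
      simpa [hinj] using congrArg r (LinearMap.congr_fun h0 x)
    let c' : Cell T D := ⟨c.idx, c.map ≫ f, hne⟩
    have hex : ∃ g : T.K c'.idx ⟶ C, g ≫ f = c'.map := ⟨c.map, rfl⟩
    have hg : hex.choose = c.map := hom_ext <| LinearMap.ext fun x => by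
      simpa [hinj, c'] using congrArg r (LinearMap.congr_fun (congrArg lin hex.choose_spec) x)
    have h1 : φ c' = cellIncl c.map := (dif_pos hex).trans (congrArg cellIncl hg)
    rw [LinearMap.comp_apply, cellsMap_cellIncl]
    exact (cellsDesc_cellIncl φ c' x).trans (LinearMap.congr_fun h1 x)
  refine ⟨attachDesc (attachInl T C ∘ₗ r) (attachInr T C ∘ₗ cellsDesc φ),
    attach_ext (fun y => by simp [hinj]) fun x => ?_, fun x => by simp⟩
  simpa using congrArg (attachInr T C) (LinearMap.congr_fun hρ x)

/-- Every morphism from a test complex to `C` becomes null-homotopic once cells are attached; the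
cell of the morphism is a nullhomotopy, up to sign. -/
theorem exists_nullHomotopy_attach {s : T.ι} {g : (T.K s).carrier →ₗ[Aᵐᵒᵖ] C.carrier} {n : ℤ}
    (hg : IsCycle g n) : ∃ h : (T.K s).carrier →ₗ[Aᵐᵒᵖ] (attach T C).carrier,
      HasDegree h (n + 1) ∧ ∀ x, attachInl T C (g x) =
        (attach T C).d (h x) - (n + 1).negOnePow • h ((T.K s).d x) := by
  have hc := isCycle_cellIncl (g := ofIsCycle g n hg) hg
  refine ⟨n.negOnePow • (attachInr T C ∘ₗ cellIncl (ofIsCycle g n hg)),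
    (hc.1.comp (hasDegree_attachInr C)).units_smul _, fun x => ?_⟩
  simp [hc.2, cellsEval_cellIncl (g := ofIsCycle g n hg) hg, smul_sub,
    smul_smul, Int.negOnePow_succ]

/-- Attaching cells is acyclic relative to all complexes to which the test complexes have only
null-homotopic morphisms. -/
theorem isRelAcyclic_attachInl (𝒞 : Cplx A → Prop)
    (h𝒞 : ∀ L, 𝒞 L → ∀ s, ∀ g : T.K s ⟶ L, IsNullHomotopic g) :
    IsRelAcyclic 𝒞 (attachInl T C) := by
  intro L hL n f hf h hh he
  -- The obstruction to extending the nullhomotopy `h` over the cells.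
  let φ : (cells T C).carrier →ₗ[Aᵐᵒᵖ] L.carrier :=
    f ∘ₗ attachInr T C + (n + 1).negOnePow • (h ∘ₗ cellsEval T C)
  have hφ : IsCycle φ (n + 1) := by
    refine ⟨HasDegree.add ?_ ?_, fun x => ?_⟩
    · have := (hasDegree_attachInr C).comp hf.1
      rwa [add_comm] at this
    · have := ((isCycle_cellsEval (T := T) C).1.comp hh).units_smul (n + 1).negOnePow
      rwa [zero_add] at this
    · have e1 := he (cellsEval T C x)
      have e2 := (isCycle_cellsEval (T := T) C).2 x
      rw [Int.negOnePow_zero, one_smul] at e2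
      simp only [φ, LinearMap.add_apply, LinearMap.smul_apply, LinearMap.comp_apply, map_add,
        LinearMap.map_sign_smul, hf.2, attach_d_inr, map_sub, e1, e2]
      rcases Int.units_eq_one_or n.negOnePow with hn | hn <;> simp [hn, Int.negOnePow_succ] <;> abel
  obtain ⟨k, hkd, hke⟩ : ∃ k : (cells T C).carrier →ₗ[Aᵐᵒᵖ] L.carrier, HasDegree k (n + 1 + 1) ∧
      ∀ x, φ x = L.d (k x) - (n + 1 + 1).negOnePow • k ((cells T C).d x) :=
    exists_nullHomotopy_shiftSum hφ fun c => h𝒞 L hL c.idx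
  refine ⟨attachDesc h k, LinearMap.ext fun x => by simp, hasDegree_attachDesc hh hkd, ?_⟩
  suffices f = L.d ∘ₗ attachDesc h k - (n + 1).negOnePow • (attachDesc h k ∘ₗ (attach T C).d) from
    LinearMap.congr_fun this
  refine attach_ext (fun y => by simp [he]) fun x => ?_
  have e : f (attachInr T C x) = φ x - (n + 1).negOnePow • h (cellsEval T C x) := by simp [φ]
  rw [e, hke, Int.negOnePow_succ (n + 1)]
  simp only [LinearMap.sub_apply, LinearMap.comp_apply, LinearMap.smul_apply, attach_d_inr, map_sub,
    attachDesc_inl, attachDesc_inr, smul_sub, Units.neg_smul]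
  abel

end Cplx

/-! ### Sequential colimits of modules -/

namespace SeqColim

variable {R : Type*} [Ring R] {G : ℕ → Type u} [∀ k, AddCommGroup (G k)] [∀ k, Module R (G k)]
  (ι : ∀ k, G k →ₗ[R] G (k + 1))

/-- The composite transition maps of a sequence of modules. -/
def trans (i j : ℕ) (h : i ≤ j) : G i →ₗ[R] G j :=
  Nat.leRec (motive := fun j _ => G i →ₗ[R] G j) LinearMap.id (fun k _ f => ι k ∘ₗ f) h

theorem trans_self (i : ℕ) : trans ι i i le_rfl = LinearMap.id := by
  simp [trans]

theorem trans_succ {i j : ℕ} (h : i ≤ j) :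
    trans ι i (j + 1) (h.trans (Nat.le_succ j)) = ι j ∘ₗ trans ι i j h := by
  simp [trans, Nat.leRec_succ _ _ h]

theorem trans_trans {i j k : ℕ} (hij : i ≤ j) (hjk : j ≤ k) (x : G i) :
    trans ι j k hjk (trans ι i j hij x) = trans ι i k (hij.trans hjk) x := by
  induction k, hjk using Nat.le_induction with
  | base => simp [trans_self]
  | succ k hjk ih => simp [trans_succ ι hjk, trans_succ ι (hij.trans hjk), ih]

instance directedSystem : DirectedSystem G (trans ι · · ·) where
  map_self i x := by simp [trans_self]
  map_map _ _ _ hij hjk x := trans_trans ι hij hjk x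

/-- A compatible family of maps on the terms of a sequence is compatible with all transition
maps. -/
theorem apply_trans {M : Type*} [AddCommGroup M] [Module R M] {f : ∀ k, G k →ₗ[R] M}
    (hf : ∀ k x, f (k + 1) (ι k x) = f k x) (i j : ℕ) (h : i ≤ j) (x : G i) :
    f j (trans ι i j h x) = f i x := by
  induction j, h using Nat.le_induction with
  | base => simp [trans_self]
  | succ j h ih => rw [trans_succ ι h, LinearMap.comp_apply, hf, ih]

theorem trans_injective (hι : ∀ k, Function.Injective (ι k)) {i j : ℕ} (h : i ≤ j) :
    Function.Injective (trans ι i j h) := by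
  induction j, h using Nat.le_induction with
  | base =>
    rw [trans_self]
    exact Function.injective_id
  | succ j h ih =>
    rw [trans_succ ι h]
    exact (hι j).comp ih

end SeqColim

/-- The colimit of a sequence of modules. -/
abbrev SeqColim {R : Type*} [Ring R] {G : ℕ → Type u} [∀ k, AddCommGroup (G k)]
    [∀ k, Module R (G k)] (ι : ∀ k, G k →ₗ[R] G (k + 1)) : Type u :=
  Module.DirectLimit G (SeqColim.trans ι)

namespace SeqColim

variable {R : Type*} [Ring R] {G : ℕ → Type u} [∀ k, AddCommGroup (G k)] [∀ k, Module R (G k)]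
  (ι : ∀ k, G k →ₗ[R] G (k + 1)) {M : Type*} [AddCommGroup M] [Module R M]

/-- The map from a term of a sequence to its colimit. -/
noncomputable def incl (k : ℕ) : G k →ₗ[R] SeqColim ι :=
  Module.DirectLimit.of R ℕ G (trans ι) k

theorem incl_trans {i j : ℕ} (h : i ≤ j) (x : G i) : incl ι j (trans ι i j h x) = incl ι i x :=
  Module.DirectLimit.of_f

theorem incl_succ (k : ℕ) (x : G k) : incl ι (k + 1) (ι k x) = incl ι k x := by
  have h := incl_trans ι (Nat.le_succ k) x
  rwa [trans_succ ι le_rfl, trans_self] at h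

theorem exists_incl (z : SeqColim ι) : ∃ k x, incl ι k x = z :=
  Module.DirectLimit.exists_of z

theorem incl_injective (hι : ∀ k, Function.Injective (ι k)) (k : ℕ) :
    Function.Injective (incl ι k) := by
  refine (injective_iff_map_eq_zero _).2 fun x hx => ?_
  obtain ⟨j, hj, h⟩ := Module.DirectLimit.of.zero_exact hx
  exact (map_eq_zero_iff _ (trans_injective ι hι hj)).1 h

/-- The map out of a sequential colimit given by a compatible family of maps. -/
noncomputable def desc (f : ∀ k, G k →ₗ[R] M) (hf : ∀ k x, f (k + 1) (ι k x) = f k x) :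
    SeqColim ι →ₗ[R] M :=
  Module.DirectLimit.lift R ℕ G (trans ι) f (apply_trans ι hf)

@[simp]
theorem desc_incl (f : ∀ k, G k →ₗ[R] M) (hf : ∀ k x, f (k + 1) (ι k x) = f k x) (k : ℕ)
    (x : G k) : desc ι f hf (incl ι k x) = f k x :=
  Module.DirectLimit.lift_of _ _ _

variable {ι}

theorem hom_ext {f g : SeqColim ι →ₗ[R] M} (h : ∀ k x, f (incl ι k x) = g (incl ι k x)) : f = g :=
  Module.DirectLimit.hom_ext fun k => LinearMap.ext (h k)

/-- A linear map from a finitely generated module to a sequential colimit has its range in a term of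
the sequence. -/
theorem exists_range_le {N : Type*} [AddCommGroup N] [Module R N] [Module.Finite R N]
    (f : N →ₗ[R] SeqColim ι) : ∃ k, LinearMap.range f ≤ LinearMap.range (incl ι k) := by
  obtain ⟨s, hs⟩ := Module.Finite.fg_top (R := R) (M := N)
  choose k y hk using fun x : N => exists_incl ι (f x)
  refine ⟨s.sup k, ?_⟩
  rw [LinearMap.range_eq_map, ← hs, Submodule.map_span, Submodule.span_le]
  rintro _ ⟨x, hx, rfl⟩
  exact ⟨trans ι _ _ (Finset.le_sup hx) (y x), by rw [incl_trans, hk]⟩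

/-- The colimit of a sequence of split injections between projective modules is projective: it is a
retract of the direct sum of the terms. -/
theorem projective [∀ k, Module.Projective R (G k)] (ρ : ∀ k, G (k + 1) →ₗ[R] G k)
    (hρ : ∀ k x, ρ k (ι k x) = x) : Module.Projective R (SeqColim ι) := by
  -- The section splits off, at each step, the complement of the previous term given by `ρ`.
  let s : ∀ k, G k →ₗ[R] Π₀ k, G k := fun k => Nat.rec (motive := fun k => G k →ₗ[R] Π₀ k, G k)
    (DFinsupp.lsingle 0)
    (fun k t => t ∘ₗ ρ k + DFinsupp.lsingle (k + 1) ∘ₗ (LinearMap.id - ι k ∘ₗ ρ k)) k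
  have hs : ∀ k, s (k + 1) =
    s k ∘ₗ ρ k + DFinsupp.lsingle (k + 1) ∘ₗ (LinearMap.id - ι k ∘ₗ ρ k) := fun _ => rfl
  have hsum : ∀ k x, DFinsupp.lsum ℕ (incl ι) (s k x) = incl ι k x := fun k => by
    induction k with
    | zero => intro x; simp [s]
    | succ k ih =>
      intro x
      simp only [hs, LinearMap.add_apply, LinearMap.comp_apply, LinearMap.sub_apply,
        LinearMap.id_apply, map_add, ih, DFinsupp.lsingle_apply, DFinsupp.lsum_single, map_sub,
        incl_succ]
      abel
  refine Module.Projective.of_split (desc ι s fun k x => ?_) (DFinsupp.lsum ℕ (incl ι))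
    (hom_ext fun k x => by simp [hsum])
  simp [hs, hρ]

end SeqColim

namespace Cplx

variable {A : Type u} [Ring A]

/-! ### Sequential colimits of complexes -/

/-- A sequence of complexes and linearly split morphisms of degree zero, uniformly bounded below. -/
structure Tower (A : Type u) [Ring A] where
  /-- The terms of the sequence. -/
  X : ℕ → Cplx A
  /-- The morphisms of the sequence. -/
  ι : ∀ k, (X k).carrier →ₗ[Aᵐᵒᵖ] (X (k + 1)).carrier
  /-- Linear retractions of the morphisms. -/
  ρ : ∀ k, (X (k + 1)).carrier →ₗ[Aᵐᵒᵖ] (X k).carrier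
  isCycle : ∀ k, IsCycle (ι k) 0
  ρ_ι : ∀ k x, ρ k (ι k x) = x
  bounded : ∃ p : ℤ, ∀ k, (X k).VanishesBelow p

namespace Tower

variable (S : Tower A)

theorem ι_injective (k : ℕ) : Function.Injective (S.ι k) :=
  Function.LeftInverse.injective (S.ρ_ι k)

theorem incl_d_ι (k : ℕ) (x : (S.X k).carrier) :
    (SeqColim.incl S.ι (k + 1) ∘ₗ (S.X (k + 1)).d) (S.ι k x) =
      (SeqColim.incl S.ι k ∘ₗ (S.X k).d) x := by
  have h := (S.isCycle k).2 x
  rw [Int.negOnePow_zero, one_smul] at h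
  simp [h, SeqColim.incl_succ]

/-- The colimit of a sequence of complexes. Its homogeneous part of degree `i` is the union of the
homogeneous parts of degree `i` of the terms. -/
noncomputable def colim : Cplx A where
  carrier := SeqColim S.ι
  gr i := ⨆ k, ((S.X k).gr i).map (SeqColim.incl S.ι k)
  isInternal := by
    refine DirectSum.isInternal_of_proj _
      (fun i => SeqColim.desc S.ι (fun k => SeqColim.incl S.ι k ∘ₗ (S.X k).proj i)
        fun k x => ?_) ?_ ?_ ?_
    · have h := (S.isCycle k).1.proj_apply i x
      rw [add_zero] at h
      simp [h, SeqColim.incl_succ]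
    · intro i
      suffices ⨆ k, ((S.X k).gr i).map (SeqColim.incl S.ι k) ≤ LinearMap.eqLocus _ LinearMap.id from
        fun x hx => this hx
      refine iSup_le fun k => Submodule.map_le_iff_le_comap.2 fun x hx => ?_
      simp [(S.X k).proj_of_mem hx]
    · intro i j hij
      suffices ⨆ k, ((S.X k).gr i).map (SeqColim.incl S.ι k) ≤ LinearMap.ker _ from
        fun x hx => this hx
      refine iSup_le fun k => Submodule.map_le_iff_le_comap.2 fun x hx => ?_
      simp [(S.X k).proj_of_mem_of_ne hij hx]
    · refine eq_top_iff.2 fun z _ => ?_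
      obtain ⟨k, x, rfl⟩ := SeqColim.exists_incl S.ι z
      have hle : ⨆ i, (S.X k).gr i ≤
          (⨆ i, ⨆ k, ((S.X k).gr i).map (SeqColim.incl S.ι k)).comap (SeqColim.incl S.ι k) :=
        iSup_le fun i y hy => Submodule.mem_iSup_of_mem i
          (Submodule.mem_iSup_of_mem k (Submodule.mem_map_of_mem hy))
      exact hle ((S.X k).iSup_gr ▸ Submodule.mem_top)
  d := SeqColim.desc S.ι (fun k => SeqColim.incl S.ι k ∘ₗ (S.X k).d) S.incl_d_ι
  d_mem i := by
    suffices ⨆ k, ((S.X k).gr i).map (SeqColim.incl S.ι k) ≤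
      (⨆ k, ((S.X k).gr (i - 1)).map (SeqColim.incl S.ι k)).comap _ from fun x hx => this hx
    refine iSup_le fun k => Submodule.map_le_iff_le_comap.2 fun x hx => ?_
    simp only [Submodule.mem_comap, SeqColim.desc_incl]
    exact Submodule.mem_iSup_of_mem k (Submodule.mem_map_of_mem ((S.X k).d_mem i x hx))
  d_d z := by
    obtain ⟨k, x, rfl⟩ := SeqColim.exists_incl S.ι z
    simp [(S.X k).d_d]
  projective := SeqColim.projective S.ρ S.ρ_ι
  bounded := by
    obtain ⟨p, hp⟩ := S.bounded
    exact ⟨p, fun i hi => by simp [hp _ i hi]⟩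

/-- The morphism from a term of a sequence of complexes to its colimit. -/
noncomputable def incl (k : ℕ) : (S.X k).carrier →ₗ[Aᵐᵒᵖ] S.colim.carrier :=
  SeqColim.incl S.ι k

theorem incl_succ (k : ℕ) (x : (S.X k).carrier) : S.incl (k + 1) (S.ι k x) = S.incl k x :=
  SeqColim.incl_succ S.ι k x

theorem exists_incl (z : S.colim.carrier) : ∃ k x, S.incl k x = z :=
  SeqColim.exists_incl S.ι z

theorem incl_injective (k : ℕ) : Function.Injective (S.incl k) :=
  SeqColim.incl_injective S.ι S.ι_injective k

theorem isCycle_incl (k : ℕ) : IsCycle (S.incl k) 0 := by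
  refine ⟨fun i x hx => ?_, fun x => ?_⟩
  · have h : SeqColim.incl S.ι k x ∈ ⨆ k, ((S.X k).gr i).map (SeqColim.incl S.ι k) :=
      Submodule.mem_iSup_of_mem k (Submodule.mem_map_of_mem hx)
    rw [add_zero]
    exact h
  · rw [Int.negOnePow_zero, one_smul]
    exact SeqColim.desc_incl S.ι _ S.incl_d_ι k x

theorem d_incl (k : ℕ) (x : (S.X k).carrier) :
    S.colim.d (S.incl k x) = S.incl k ((S.X k).d x) := by
  rw [(S.isCycle_incl k).2, Int.negOnePow_zero, one_smul]

theorem colim_vanishesBelow {p : ℤ} (hp : ∀ k, (S.X k).VanishesBelow p) :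
    S.colim.VanishesBelow p := fun i hi =>
  eq_bot_iff.2 <| iSup_le fun k => by
    rw [hp k i hi, Submodule.map_bot]
    exact le_rfl

section desc

variable {M : Type*} [AddCommGroup M] [Module Aᵐᵒᵖ M]

/-- The linear map out of the colimit given by a compatible family of linear maps. -/
noncomputable def desc (f : ∀ k, (S.X k).carrier →ₗ[Aᵐᵒᵖ] M)
    (hf : ∀ k x, f (k + 1) (S.ι k x) = f k x) : S.colim.carrier →ₗ[Aᵐᵒᵖ] M :=
  SeqColim.desc S.ι f hf

@[simp]
theorem desc_incl (f : ∀ k, (S.X k).carrier →ₗ[Aᵐᵒᵖ] M)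
    (hf : ∀ k x, f (k + 1) (S.ι k x) = f k x) (k : ℕ) (x : (S.X k).carrier) :
    S.desc f hf (S.incl k x) = f k x :=
  SeqColim.desc_incl S.ι f hf k x

variable {S} in
theorem colim_ext {f g : S.colim.carrier →ₗ[Aᵐᵒᵖ] M}
    (h : ∀ k x, f (S.incl k x) = g (S.incl k x)) : f = g :=
  SeqColim.hom_ext h

end desc

theorem hasDegree_desc {D : Cplx A} {f : ∀ k, (S.X k).carrier →ₗ[Aᵐᵒᵖ] D.carrier}
    {hf : ∀ k x, f (k + 1) (S.ι k x) = f k x} {n : ℤ} (h : ∀ k, HasDegree (f k) n) :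
    HasDegree (S.desc f hf) n := fun i => by
  suffices ⨆ k, ((S.X k).gr i).map (S.incl k) ≤ (D.gr (i + n)).comap (S.desc f hf) from
    fun x hx => this hx
  refine iSup_le fun k => Submodule.map_le_iff_le_comap.2 fun x hx => ?_
  rw [Submodule.mem_comap, Submodule.mem_comap, desc_incl]
  exact h k i x hx

theorem isCycle_desc {D : Cplx A} {f : ∀ k, (S.X k).carrier →ₗ[Aᵐᵒᵖ] D.carrier}
    {hf : ∀ k x, f (k + 1) (S.ι k x) = f k x} {n : ℤ} (h : ∀ k, IsCycle (f k) n) :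
    IsCycle (S.desc f hf) n := by
  refine ⟨S.hasDegree_desc fun k => (h k).1, fun z => ?_⟩
  obtain ⟨k, x, rfl⟩ := S.exists_incl z
  simp [S.d_incl, (h k).2]

/-- A morphism from a finitely generated complex to a colimit factors through a term. -/
theorem exists_factor {K : Cplx A} [Module.Finite Aᵐᵒᵖ K.carrier] {n : ℤ}
    {f : K.carrier →ₗ[Aᵐᵒᵖ] S.colim.carrier} (hf : IsCycle f n) :
    ∃ (k : ℕ) (g : K.carrier →ₗ[Aᵐᵒᵖ] (S.X k).carrier), IsCycle g n ∧ S.incl k ∘ₗ g = f := by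
  obtain ⟨k, hk⟩ := SeqColim.exists_range_le (ι := S.ι) f
  have hk' : ∀ x, f x ∈ LinearMap.range (S.incl k) := fun x => hk ⟨x, rfl⟩
  let g := (LinearEquiv.ofInjective (S.incl k) (S.incl_injective k)).symm.toLinearMap ∘ₗ
    f.codRestrict _ hk'
  have hg : ∀ x, S.incl k (g x) = f x := fun x => by
    have h := congrArg Subtype.val ((LinearEquiv.ofInjective (S.incl k)
      (S.incl_injective k)).apply_symm_apply (f.codRestrict _ hk' x))
    rwa [LinearEquiv.ofInjective_apply] at h
  refine ⟨k, g, ⟨fun i x hx => ?_, fun x => S.incl_injective k ?_⟩, LinearMap.ext hg⟩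
  · refine (S.isCycle_incl k).1.mem_of_apply_mem (S.incl_injective k) ?_
    rw [hg, add_zero]
    exact hf.1 i x hx
  · rw [← d_incl, hg, hf.2, LinearMap.map_sign_smul, hg]

/-- The inclusion of the first term of a sequence of complexes into the colimit has a linear
retraction. -/
theorem exists_retraction :
    ∃ r : S.colim.carrier →ₗ[Aᵐᵒᵖ] (S.X 0).carrier, r ∘ₗ S.incl 0 = LinearMap.id := by
  let r : ∀ k, (S.X k).carrier →ₗ[Aᵐᵒᵖ] (S.X 0).carrier := fun k =>
    Nat.rec (motive := fun k => (S.X k).carrier →ₗ[Aᵐᵒᵖ] (S.X 0).carrier) LinearMap.id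
      (fun k t => t ∘ₗ S.ρ k) k
  have hr : ∀ k x, r (k + 1) (S.ι k x) = r k x := fun k x => congrArg (r k) (S.ρ_ι k x)
  exact ⟨S.desc r hr, LinearMap.ext fun x => S.desc_incl r hr 0 x⟩

/-- If all morphisms of a sequence are relatively acyclic, so is the inclusion of the first term into
the colimit: nullhomotopies are extended one step at a time. -/
theorem isRelAcyclic_incl {𝒞 : Cplx A → Prop} (h : ∀ k, IsRelAcyclic 𝒞 (S.ι k)) :
    IsRelAcyclic 𝒞 (S.incl 0) := by
  intro L hL n f hf h₀ hd he
  let Ext : ℕ → Type u := fun k => { t : (S.X k).carrier →ₗ[Aᵐᵒᵖ] L.carrier //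
    HasDegree t (n + 1) ∧ ∀ x, f (S.incl k x) = L.d (t x) - (n + 1).negOnePow • t ((S.X k).d x) }
  have step : ∀ k (t : Ext k), ∃ t' : Ext (k + 1), t'.1 ∘ₗ S.ι k = t.1 := fun k t => by
    have hc := (S.isCycle_incl (k + 1)).comp hf
    rw [zero_add] at hc
    obtain ⟨t', h1, h2, h3⟩ := h k L hL n _ hc t.1 t.2.1 fun x => by
      rw [LinearMap.comp_apply, S.incl_succ]
      exact t.2.2 x
    exact ⟨⟨t', h2, h3⟩, h1⟩
  choose next hnext using step
  let t : ∀ k, Ext k := fun k => Nat.rec ⟨h₀, hd, he⟩ next k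
  have ht : ∀ k x, (t (k + 1)).1 (S.ι k x) = (t k).1 x := fun k x =>
    LinearMap.congr_fun (hnext k (t k)) x
  refine ⟨S.desc (fun k => (t k).1) ht,
    LinearMap.ext fun x => S.desc_incl (fun k => (t k).1) ht 0 x,
    S.hasDegree_desc fun k => (t k).2.1, fun z => ?_⟩
  obtain ⟨k, x, rfl⟩ := S.exists_incl z
  rw [S.d_incl, S.desc_incl, S.desc_incl]
  exact (t k).2.2 x

end Tower

/-! ### The localization functor -/

variable (T : TestFamily A)

/-- The `k`-fold iteration of attaching cells. -/
noncomputable def iter : ℕ → Cplx A ⥤ Cplx A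
  | 0 => 𝟭 _
  | k + 1 => iter k ⋙ attachFunctor T

variable {T} {C D : Cplx A}

theorem isCycle_iter {f : C ⟶ D} {n : ℤ} (hf : IsCycle (lin f) n) (k : ℕ) :
    IsCycle (lin ((iter T k).map f)) n := by
  induction k with
  | zero => exact hf
  | succ k ih => exact isCycle_attachMap ih

theorem iter_vanishesBelow {p : ℤ} (hp : C.VanishesBelow p) (k : ℕ) :
    ((iter T k).obj C).VanishesBelow p := by
  induction k with
  | zero => exact hp
  | succ k ih => exact attach_vanishesBelow ih

variable (T) in
/-- The sequence of complexes obtained by iterating the attachment of cells. -/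
noncomputable def tower (C : Cplx A) : Tower A where
  X k := (iter T k).obj C
  ι k := attachInl T ((iter T k).obj C)
  ρ k := attachDesc (T := T) (C := (iter T k).obj C) LinearMap.id 0
  isCycle k := isCycle_attachInl _
  ρ_ι k x := attachDesc_inl _ _ x
  bounded := by
    obtain ⟨p, hp⟩ := C.bounded
    exact ⟨p, iter_vanishesBelow hp⟩

variable (T) in
/-- The map of colimits induced by a morphism. -/
noncomputable def colimMap (f : C ⟶ D) :
    (tower T C).colim.carrier →ₗ[Aᵐᵒᵖ] (tower T D).colim.carrier :=
  (tower T C).desc (fun k => (tower T D).incl k ∘ₗ lin ((iter T k).map f)) fun k x =>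
    (congrArg ((tower T D).incl (k + 1)) (attachMap_inl ((iter T k).map f) x)).trans
      ((tower T D).incl_succ k _)

@[simp]
theorem colimMap_incl (f : C ⟶ D) (k : ℕ) (x : ((tower T C).X k).carrier) :
    colimMap T f ((tower T C).incl k x) = (tower T D).incl k (lin ((iter T k).map f) x) :=
  Tower.desc_incl _ _ _ k x

theorem isCycle_colimMap {f : C ⟶ D} {n : ℤ} (hf : IsCycle (lin f) n) :
    IsCycle (colimMap T f) n :=
  Tower.isCycle_desc _ fun k => by
    have := (isCycle_iter (T := T) hf k).comp ((tower T D).isCycle_incl k)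
    rwa [add_zero] at this

variable (T) in
/-- The localization functor: attach cells repeatedly and pass to the colimit. -/
noncomputable def localization : Cplx A ⥤ Cplx A where
  obj C := (tower T C).colim
  map f := ofIsCycle (colimMap T f) _ (isCycle_colimMap (exists_isCycle_lin f).choose_spec)
  map_id C := hom_ext <| Tower.colim_ext fun k x => by
    refine (colimMap_incl (𝟙 C) k x).trans ?_
    rw [(iter T k).map_id]
    rfl
  map_comp {C D E} f g := hom_ext <| Tower.colim_ext fun k x => by
    refine (colimMap_incl (f ≫ g) k x).trans ?_
    rw [(iter T k).map_comp]
    exact ((congrArg (colimMap T g) (colimMap_incl f k x)).trans (colimMap_incl g k _)).symm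

variable (T) in
/-- The inclusion of a complex into its localization. -/
noncomputable def toLocalization : 𝟭 (Cplx A) ⟶ localization T where
  app C := ofIsCycle (D := (tower T C).colim) ((tower T C).incl 0) 0 ((tower T C).isCycle_incl 0)
  naturality _ _ f := hom_ext (LinearMap.ext fun x => (colimMap_incl f 0 x).symm)

/-- A linear retraction of a morphism extends through all stages of the construction. -/
theorem exists_colimMap_retraction (f : C ⟶ D) (r : D.carrier →ₗ[Aᵐᵒᵖ] C.carrier)
    (hr : r ∘ₗ lin f = LinearMap.id) :
    ∃ r' : (tower T D).colim.carrier →ₗ[Aᵐᵒᵖ] (tower T C).colim.carrier,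
      r' ∘ₗ colimMap T f = LinearMap.id := by
  let Ret : ℕ → Type u := fun k =>
    { t : ((tower T D).X k).carrier →ₗ[Aᵐᵒᵖ] ((tower T C).X k).carrier //
      t ∘ₗ lin ((iter T k).map f) = LinearMap.id }
  have step : ∀ k (t : Ret k), ∃ t' : Ret (k + 1),
      ∀ x, t'.1 ((tower T D).ι k x) = (tower T C).ι k (t.1 x) := fun k t => by
    obtain ⟨t', h1, h2⟩ := exists_attachMap_retraction (T := T) _ t.1 t.2
    exact ⟨⟨t', h1⟩, h2⟩
  choose next hnext using step
  let t : ∀ k, Ret k := fun k => Nat.rec ⟨r, hr⟩ next k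
  refine ⟨(tower T D).desc (fun k => (tower T C).incl k ∘ₗ (t k).1) fun k x => ?_,
    Tower.colim_ext fun k x => ?_⟩
  · exact (congrArg ((tower T C).incl (k + 1)) (hnext k (t k) x)).trans
      ((tower T C).incl_succ k _)
  · rw [LinearMap.comp_apply, colimMap_incl]
    refine (Tower.desc_incl _ (fun k => (tower T C).incl k ∘ₗ (t k).1) _ k _).trans ?_
    exact congrArg ((tower T C).incl k) (LinearMap.congr_fun (t k).2 x)

/-- Every morphism from a test complex to the localization is null-homotopic: it factors through
some stage and becomes null-homotopic at the next one. -/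
theorem exists_nullHomotopy_localization {s : T.ι} {n : ℤ}
    {f : (T.K s).carrier →ₗ[Aᵐᵒᵖ] (tower T C).colim.carrier} (hf : IsCycle f n) :
    ∃ h : (T.K s).carrier →ₗ[Aᵐᵒᵖ] (tower T C).colim.carrier, HasDegree h (n + 1) ∧
      ∀ x, f x = (tower T C).colim.d (h x) - (n + 1).negOnePow • h ((T.K s).d x) := by
  have := T.finite s
  obtain ⟨k, g, hg, rfl⟩ := (tower T C).exists_factor hf
  obtain ⟨h, hh, e⟩ : ∃ h : (T.K s).carrier →ₗ[Aᵐᵒᵖ] ((tower T C).X (k + 1)).carrier,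
      HasDegree h (n + 1) ∧ ∀ x, (tower T C).ι k (g x) =
        ((tower T C).X (k + 1)).d (h x) - (n + 1).negOnePow • h ((T.K s).d x) :=
    exists_nullHomotopy_attach hg
  refine ⟨(tower T C).incl (k + 1) ∘ₗ h, ?_, fun x => ?_⟩
  · have := hh.comp ((tower T C).isCycle_incl (k + 1)).1
    rwa [add_zero] at this
  · rw [LinearMap.comp_apply, ← (tower T C).incl_succ, e, map_sub, LinearMap.map_sign_smul,
      ← (tower T C).d_incl]
    rfl

/-! ### A small family of two-term complexes -/

variable (W : MorphismProperty (FGProj A))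

theorem IsTwoTerm.narrow {W : MorphismProperty (FGProj A)} {K : Cplx A} (hK : IsTwoTerm W K) :
    ∃ n : ℤ, ∀ i, i ≠ n + 1 → i ≠ n → K.gr i = ⊥ := by
  obtain ⟨n, P, Q, α, eP, eQ, hα, hd, hn⟩ := hK
  exact ⟨n, hn⟩

theorem IsTwoTerm.finite {W : MorphismProperty (FGProj A)} {K : Cplx A} (hK : IsTwoTerm W K) :
    Module.Finite Aᵐᵒᵖ K.carrier := by
  obtain ⟨n, P, Q, α, eP, eQ, hα, hd, hn⟩ := hK
  have := P.property.1
  have := Q.property.1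
  have h1 : (K.gr (n + 1)).FG := Module.Finite.iff_fg.1 (Module.Finite.equiv eP)
  have h2 : (K.gr n).FG := Module.Finite.iff_fg.1 (Module.Finite.equiv eQ)
  refine ⟨?_⟩
  have htop : (⊤ : Submodule Aᵐᵒᵖ K.carrier) = K.gr (n + 1) ⊔ K.gr n := by
    refine (eq_top_iff.2 ?_).symm
    rw [← K.iSup_gr]
    refine iSup_le fun i => ?_
    by_cases h₁ : i = n + 1
    · exact h₁ ▸ le_sup_left
    by_cases h₂ : i = n
    · exact h₂ ▸ le_sup_right
    · simp [hn i h₁ h₂]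
  rw [htop]
  exact h1.sup h2

/-- Data for a graded module with an endomorphism on a submodule of a finitely generated free
module. These data form a small type. -/
structure Model (A : Type u) [Ring A] where
  /-- The rank of the free module. -/
  rank : ℕ
  /-- The underlying submodule. -/
  M : Submodule Aᵐᵒᵖ (Fin rank → Aᵐᵒᵖ)
  /-- The homogeneous parts. -/
  gr : ℤ → Submodule Aᵐᵒᵖ M
  /-- The endomorphism. -/
  d : M →ₗ[Aᵐᵒᵖ] M

/-- The graded differential module underlying a complex is isomorphic to the given model. -/
def IsModelOf (m : Model A) (K : Cplx A) : Prop :=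
  ∃ e : K.carrier ≃ₗ[Aᵐᵒᵖ] m.M, (∀ i x, x ∈ K.gr i ↔ e x ∈ m.gr i) ∧ ∀ x, e (K.d x) = m.d (e x)

/-- A complex with finitely generated underlying module has a model, since this module is projective
and hence embeds into a finitely generated free module. -/
theorem exists_isModelOf (K : Cplx A) [Module.Finite Aᵐᵒᵖ K.carrier] :
    ∃ m : Model A, IsModelOf m K := by
  obtain ⟨n, f, hf⟩ := Module.Finite.exists_fin' Aᵐᵒᵖ K.carrier
  obtain ⟨g, hg⟩ := Module.projective_lifting_property f LinearMap.id hf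
  have hinj : Function.Injective g := Function.LeftInverse.injective (LinearMap.congr_fun hg)
  let e := LinearEquiv.ofInjective g hinj
  refine ⟨⟨n, LinearMap.range g, fun i => (K.gr i).map e.toLinearMap,
    e.toLinearMap ∘ₗ K.d ∘ₗ e.symm.toLinearMap⟩, e, fun i x => ?_, fun x => ?_⟩
  · exact ⟨fun hx => ⟨x, hx, rfl⟩, fun ⟨y, hy, h⟩ => e.injective h ▸ hy⟩
  · simp

/-- The two-term complexes with differential in `W`, one for each model that occurs. -/
noncomputable def twoTermFamily : TestFamily A where
  ι := { m : Model A // ∃ K : Cplx A, IsTwoTerm W K ∧ IsModelOf m K }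
  K s := s.2.choose
  narrow s := s.2.choose_spec.1.narrow
  finite s := s.2.choose_spec.1.finite

variable {W}

theorem isTwoTerm_twoTermFamily (s : (twoTermFamily W).ι) : IsTwoTerm W ((twoTermFamily W).K s) :=
  s.2.choose_spec.1

/-- Every two-term complex with differential in `W` is isomorphic to a member of the family. -/
theorem exists_equiv_twoTermFamily {K : Cplx A} (hK : IsTwoTerm W K) :
    ∃ (s : (twoTermFamily W).ι) (e : K.carrier ≃ₗ[Aᵐᵒᵖ] ((twoTermFamily W).K s).carrier),
      IsCycle e.toLinearMap 0 ∧ IsCycle e.symm.toLinearMap 0 := by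
  have := hK.finite
  obtain ⟨m, hm⟩ := exists_isModelOf K
  let s : (twoTermFamily W).ι := ⟨m, K, hK, hm⟩
  obtain ⟨e, hgr, hd⟩ := hm
  obtain ⟨e', hgr', hd'⟩ : IsModelOf m ((twoTermFamily W).K s) := s.2.choose_spec.2
  refine ⟨s, e.trans e'.symm, ⟨fun i x hx => ?_, fun x => e'.injective ?_⟩,
    ⟨fun i x hx => ?_, fun x => e.injective ?_⟩⟩
  · simpa [hgr'] using (hgr i x).1 hx
  · simp [hd, hd']
  · simpa [hgr] using (hgr' i x).1 hx
  · simp [hd, hd']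

theorem isLocal_localization (C : Cplx A) : IsLocal W (tower (twoTermFamily W) C).colim := by
  intro K hK f
  obtain ⟨s, e, he, he'⟩ := exists_equiv_twoTermFamily hK
  obtain ⟨n, hf⟩ := exists_isCycle_lin f
  obtain ⟨h, hh, heq⟩ := exists_nullHomotopy_localization (he'.comp hf)
  refine ⟨0 + (0 + n + 1), h ∘ₗ e.toLinearMap, he.1.comp hh, fun x => ?_⟩
  have h1 := heq (e x)
  have h2 := he.2 x
  rw [Int.negOnePow_zero, one_smul] at h2
  simp only [LinearMap.comp_apply, LinearEquiv.coe_coe, LinearEquiv.symm_apply_apply] at h1 h2 ⊢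
  rw [h1, h2, zero_add (0 + n + 1)]

theorem isWLocalization_toLocalization (C : Cplx A) :
    IsWLocalization W ((toLocalization (twoTermFamily W)).app C) := by
  refine ⟨(isCofibration_iff _).2 (Tower.exists_retraction _), isLocal_localization C, 0,
    (tower _ C).isCycle_incl 0, ?_⟩
  refine IsRelAcyclic.isAcyclicWrt_cone _ (Tower.isRelAcyclic_incl _ fun k => ?_)
  exact isRelAcyclic_attachInl _ fun L hL s g => hL _ (isTwoTerm_twoTermFamily s) g

end Cplx

theorem mainTheorem5 (A : Type u) [Ring A] (W : MorphismProperty (FGProj A)) :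
    ∃ (Φ : Cplx A ⥤ Cplx A) (lam : 𝟭 (Cplx A) ⟶ Φ),
      (∀ (C D : Cplx A) (f : C ⟶ D) (n : ℤ),
        Cplx.HasDegree (Cplx.lin f) n → Cplx.HasDegree (Cplx.lin (Φ.map f)) n) ∧
      (∀ C : Cplx A, Cplx.HasDegree (C := C) (D := Φ.obj C) (Cplx.lin (lam.app C)) 0) ∧
      (∀ C : Cplx A, Cplx.IsWLocalization W (C := C) (D := Φ.obj C) (lam.app C)) ∧
      (∀ (C D : Cplx A) (f : C ⟶ D), Cplx.IsCofibration f → Cplx.IsCofibration (Φ.map f)) ∧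
      (∀ (C : Cplx A) (p : ℤ), C.VanishesBelow p → (Φ.obj C).VanishesBelow p) := by
  refine ⟨Cplx.localization (Cplx.twoTermFamily W), Cplx.toLocalization (Cplx.twoTermFamily W),
    fun C D f n hf => (Cplx.isCycle_colimMap hf.isCycle_lin).1,
    fun C => ((Cplx.tower _ C).isCycle_incl 0).1,
    Cplx.isWLocalization_toLocalization, fun C D f hf => ?_,
    fun C p hp => Cplx.Tower.colim_vanishesBelow _ (Cplx.iter_vanishesBelow hp)⟩
  obtain ⟨r, hr⟩ := (Cplx.isCofibration_iff f).1 hf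
  exact (Cplx.isCofibration_iff _).2 (Cplx.exists_colimMap_retraction f r hr)
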